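/- Let $d\ge 1$ and let $\alpha,\beta\in\mathbb R^d$ with $\alpha_i,\beta_i>-\tfrac12$ for all $i$. Let $$\mu^d_{\alpha,\beta}(dx)=\prod_{i=1}^d\frac{(1-x_i)^{\alpha_i}(1+x_i)^{\beta_i}}{2^{\alpha_i+\beta_i+1}B(\alpha_i+1,\beta_i+1)}\,dx_i$$ be the normalized Jacobi measure on $[-1,1]^d$. For $\kappa\in\mathbb N^d$ let $\vec p_\kappa(x)=\prod_i p_{\kappa_i}^{\alpha_i,\beta_i}(x_i)$ be the Jacobi polynomials, orthonormal in $L^2(\mu^d_{\alpha,\beta})$, and let $\lambda_\kappa=\sum_i\kappa_i(\kappa_i+\alpha_i+\beta_i+1)$. Let $T_t$ be the Jacobi semigroup, given by $T_0f=f$ and, for $t>0$, $$T_tf(x)=\int_{[-1,1]^d}f(y)\sum_{\kappa\in\mathbb N^d}e^{-\lambda_\kappa t}\,\vec p_\kappa(x)\,\vec p_\kappa(y)\,\mu^d_{\alpha,\beta}(dy),$$ and let $$P_tf(x)=\frac1{\sqrt\pi}\int_0^\infty\frac{e^{-u}}{\sqrt u}\,T_{t^2/4u}f(x)\,du$$ be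 the Poisson–Jacobi semigroup. Put $$d_{\alpha,\beta}=\min_{1\le j\le d}(\alpha_j+\beta_j+2).$$ Let $f\in C^2([-1,1]^d)$ satisfy $\int_{[-1,1]^d}f\,d\mu^d_{\alpha,\beta}=0$. Then there is a constant $C$, depending only on $f,\alpha,\beta,d$, such that for every $x\in[-1,1]^d$ the function $t\mapsto P_tf(x)$ is differentiable on $(0,\infty)$, $$\Big|\frac{\partial}{\partial t}P_tf(x)\Big|\le C\,(1+|x|)\,e^{-d_{\alpha,\beta}^{1/2}\,t}\qquad(t>0),$$ and $$|P_tf(x)|\le C\,(1+|x|)\,e^{-d_{\alpha,\beta}^{1/2}\,t}\qquad(t\ge 0),$$ where $|x|$ is the Euclidean norm. -/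

import Mathlib

open MeasureTheory Set

/-- The normalized one-dimensional Jacobi measure
`(1 - x)^a (1 + x)^b dx / (2^(a+b+1) B(a+1, b+1))` on `[-1, 1]`. -/
noncomputable def jacobiMeasure (a b : ℝ) : Measure ℝ :=
  (volume.restrict (Icc (-1) 1)).withDensity fun x =>
    ENNReal.ofReal ((1 - x) ^ a * (1 + x) ^ b /
      (2 ^ (a + b + 1) * ProbabilityTheory.beta (a + 1) (b + 1)))

/-- The normalized `d`-dimensional Jacobi measure on `[-1, 1]^d`. -/
noncomputable def jacobiMeasurePi {d : ℕ} (α β : Fin d → ℝ) : Measure (Fin d → ℝ) :=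
  Measure.pi fun i => jacobiMeasure (α i) (β i)

/-- The generalized binomial coefficient `r (r - 1) ⋯ (r - k + 1) / k!`. -/
noncomputable def realChoose (r : ℝ) (k : ℕ) : ℝ :=
  (descPochhammer ℝ k).eval r / (k.factorial : ℝ)

/-- The classical Jacobi polynomial of degree `n` (before normalization), as a function on `ℝ`.
See `jacobiP_rodrigues` for Rodrigues' formula. -/
noncomputable def jacobiP (a b : ℝ) (n : ℕ) (x : ℝ) : ℝ :=
  ∑ k ∈ Finset.range (n + 1), realChoose (n + a) k * realChoose (n + b) (n - k) *
    ((x - 1) / 2) ^ (n - k) * ((x + 1) / 2) ^ k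

/-- Rodrigues' formula on `(-1, 1)`: it shows that `jacobiP` is the usual Jacobi polynomial. -/
theorem jacobiP_rodrigues (a b : ℝ) (n : ℕ) {x : ℝ} (hx : x ∈ Ioo (-1 : ℝ) 1) :
    (1 - x) ^ a * (1 + x) ^ b * jacobiP a b n x =
      (-1) ^ n / (2 ^ n * (n.factorial : ℝ)) *
        iteratedDeriv n (fun y : ℝ => (1 - y) ^ (a + n) * (1 + y) ^ (b + n)) x := by
  have h1 : 0 < 1 - x := by linarith [hx.2]
  have h2 : 0 < 1 + x := by linarith [hx.1]
  have hA : ContDiffAt ℝ n (fun y : ℝ => (1 - y) ^ (a + n)) x :=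
    (contDiffAt_const.sub contDiffAt_id).rpow_const_of_ne h1.ne'
  have hB : ContDiffAt ℝ n (fun y : ℝ => (1 + y) ^ (b + n)) x :=
    (contDiffAt_const.add contDiffAt_id).rpow_const_of_ne h2.ne'
  have e := iteratedDeriv_mul hA hB
  have e' : (fun y : ℝ => (1 - y) ^ (a + n) * (1 + y) ^ (b + n)) =
    (fun y : ℝ => (1 - y) ^ (a + n)) * (fun y : ℝ => (1 + y) ^ (b + n)) := rfl
  rw [e', e, jacobiP, Finset.mul_sum, Finset.mul_sum]
  refine Finset.sum_congr rfl fun k hk => ?_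
  have hk : k ≤ n := by
    have := Finset.mem_range.1 hk
    omega
  have d1 : iteratedDeriv k (fun y : ℝ => (1 - y) ^ (a + n)) x =
      (-1) ^ k * ((descPochhammer ℝ k).eval (a + n) * (1 - x) ^ (a + n - k)) := by
    have := congrFun (iteratedDeriv_comp_const_sub k (fun y : ℝ => y ^ (a + n)) 1) x
    simp only [smul_eq_mul] at this
    rw [this, iteratedDeriv_eq_iterate, Real.iter_deriv_rpow_const]
  have d2 : iteratedDeriv (n - k) (fun y : ℝ => (1 + y) ^ (b + n)) x =
      (descPochhammer ℝ (n - k)).eval (b + n) * (1 + x) ^ (b + n - (n - k : ℕ)) := by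
    have := congrFun (iteratedDeriv_comp_const_add (n - k) (fun y : ℝ => y ^ (b + n)) 1) x
    rw [this, iteratedDeriv_eq_iterate, Real.iter_deriv_rpow_const]
  have p1 : (1 - x) ^ (a + n - k) = (1 - x) ^ a * (1 - x) ^ (n - k) := by
    rw [← Real.rpow_natCast (1 - x) (n - k), ← Real.rpow_add h1, Nat.cast_sub hk, add_sub_assoc]
  have p2 : (1 + x) ^ (b + n - (n - k : ℕ)) = (1 + x) ^ b * (1 + x) ^ k := by
    rw [← Real.rpow_natCast (1 + x) k, ← Real.rpow_add h2, Nat.cast_sub hk]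
    congr 1
    ring
  have hs : (x - 1) ^ (n - k) = (-1) ^ n * (-1) ^ k * (1 - x) ^ (n - k) := by
    have : x - 1 = (-1) * (1 - x) := by ring
    rw [this, mul_pow]
    congr 1
    obtain ⟨m, rfl⟩ := Nat.exists_eq_add_of_le hk
    rw [Nat.add_sub_cancel_left, pow_add]
    have : ((-1 : ℝ) ^ k) * (-1) ^ k = 1 := by rw [← mul_pow]; simp
    linear_combination (-(-1 : ℝ) ^ m) * this
  have hn2 : (2 : ℝ) ^ n = 2 ^ (n - k) * 2 ^ k := by rw [← pow_add, Nat.sub_add_cancel hk]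
  have hf : ((n.choose k : ℕ) : ℝ) = n.factorial / (k.factorial * (n - k).factorial) :=
    Nat.cast_choose ℝ hk
  have g1 : (n.factorial : ℝ) ≠ 0 := by positivity
  have g2 : (k.factorial : ℝ) ≠ 0 := by positivity
  have g3 : ((n - k).factorial : ℝ) ≠ 0 := by positivity
  rw [d1, d2, p1, p2, div_pow, div_pow, hs, hn2, hf, realChoose, realChoose,
    add_comm (n : ℝ) a, add_comm (n : ℝ) b, add_comm x 1]
  field_simp

/-- The Jacobi polynomial of degree `n`, normalized in `L²` of the Jacobi measure. -/
noncomputable def jacobiPNormalized (a b : ℝ) (n : ℕ) (x : ℝ) : ℝ :=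
  jacobiP a b n x / √(∫ y, jacobiP a b n y ^ 2 ∂(jacobiMeasure a b))

/-- The normalized `d`-dimensional Jacobi polynomial of multi-index `κ`. -/
noncomputable def jacobiPoly {d : ℕ} (α β : Fin d → ℝ) (κ : Fin d → ℕ) (x : Fin d → ℝ) : ℝ :=
  ∏ i, jacobiPNormalized (α i) (β i) (κ i) (x i)

/-- `λ_κ`, the eigenvalue of minus the Jacobi operator for the multi-index `κ`. -/
noncomputable def jacobiEigenvalue {d : ℕ} (α β : Fin d → ℝ) (κ : Fin d → ℕ) : ℝ :=
  ∑ i, (κ i : ℝ) * (κ i + α i + β i + 1)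

/-- The density `p(t, x, y)`, `t > 0`, of the Jacobi semigroup with respect to the Jacobi
measure. -/
noncomputable def jacobiKernel {d : ℕ} (α β : Fin d → ℝ) (t : ℝ) (x y : Fin d → ℝ) : ℝ :=
  ∑' κ : Fin d → ℕ,
    Real.exp (-jacobiEigenvalue α β κ * t) * jacobiPoly α β κ x * jacobiPoly α β κ y

/-- The Jacobi semigroup `T_t`, `t ≥ 0`, given by its kernel for `t > 0`, with `T_0 f = f`. -/
noncomputable def jacobiSemigroup {d : ℕ} (α β : Fin d → ℝ) (t : ℝ)
    (f : (Fin d → ℝ) → ℝ) (x : Fin d → ℝ) : ℝ :=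
  if t = 0 then f x else ∫ y, f y * jacobiKernel α β t x y ∂(jacobiMeasurePi α β)

/-- The Poisson–Jacobi semigroup `P_t`, `t ≥ 0`, by Bochner's subordination formula. -/
noncomputable def poissonJacobi {d : ℕ} (α β : Fin d → ℝ) (t : ℝ)
    (f : (Fin d → ℝ) → ℝ) (x : Fin d → ℝ) : ℝ :=
  1 / √Real.pi * ∫ u in Ioi (0 : ℝ),
    Real.exp (-u) / √u * jacobiSemigroup α β (t ^ 2 / (4 * u)) f x

/-- `d_{α,β} = min_j (α_j + β_j + 2)`. -/
noncomputable def jacobiGap {d : ℕ} (α β : Fin d → ℝ) : ℝ :=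
  ⨅ j, (α j + β j + 2)

/-! Let L be the Jacobi operator, the sum over i of (1 - x_i²)∂_i² + (β_i - α_i - (α_i + β_i + 2)
x_i)∂_i. The polynomials p_κ are eigenfunctions of L with eigenvalue -λ_κ. Since α_i + β_i + 1 > 0,
every κ ≠ 0 has λ_κ ≥ γ, where γ is `jacobiGap`. A function of mean zero has no component at κ = 0,
so T_t should decay like exp(-γt) on it.

The decay is needed uniformly on the cube (`exists_abs_jacobiSemigroup_le`), and two arguments share
it. For t ≤ 1, T_t is a sup norm contraction (`abs_jacobiSemigroup_le`): the kernel is a product of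
one-dimensional kernels, each of total mass one and nonnegative almost everywhere. Nonnegativity
comes from a maximum principle for polynomial data (`jacobi_heat_nonneg`) and Weierstrass
approximation. For t ≥ 1 the eigenfunction series is summed directly. A crude sup norm bound of
order n^(2n) for normalized polynomials (`sq_eval_mul_le_of_jacobiOp`) suffices, because the heat
factor decays like exp(-n²t).

For the time derivative, put g = L f, which is continuous on the closed cube since f is C².
Integration by parts multiplies the coefficients of f by -λ_κ (`exists_jacobiLaplacian`). Hence d/dt
T_t f = T_t g, and T_t g obeys the same decay estimate, with no singularity at t = 0.

Subordination turns exp(-γs) into exp(-√γ t) through two explicit integrals,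
`integral_exp_neg_div_sqrt` for P_t f and `integral_exp_neg_div_sqrt_mul` for its derivative. All
bounds are uniform in x, and the factor 1 + |x| ≥ 1 is inserted only at the end. -/

/-! ### The Jacobi differential equation for polynomials. -/

section JacobiODE

open Polynomial

/-- The Jacobi operator `(1 - x²) p'' + (b - a - (a + b + 2) x) p'` on polynomials. -/
noncomputable def jacobiOp (a b : ℝ) (p : ℝ[X]) : ℝ[X] :=
  (1 - X ^ 2) * derivative (derivative p) + (C (b - a) - C (a + b + 2) * X) * derivative p

/-- The Jacobi polynomial as an element of `ℝ[X]`. -/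
noncomputable def jacobiPolynomial (a b : ℝ) (n : ℕ) : ℝ[X] :=
  ∑ k ∈ Finset.range (n + 1), C (realChoose (n + a) k * realChoose (n + b) (n - k)) *
    ((C (1 / 2) * (X - 1)) ^ (n - k) * (C (1 / 2) * (X + 1)) ^ k)

theorem jacobiPolynomial_eval (a b : ℝ) (n : ℕ) (x : ℝ) :
    (jacobiPolynomial a b n).eval x = jacobiP a b n x := by
  rw [jacobiPolynomial, jacobiP, eval_finsetSum]
  refine Finset.sum_congr rfl fun k _ => ?_
  simp only [eval_mul, eval_C, eval_pow, eval_sub, eval_add, eval_X, eval_one]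
  ring

theorem jacobiOp_sum {ι : Type*} (a b : ℝ) (s : Finset ι) (c : ι → ℝ) (p : ι → ℝ[X]) :
    jacobiOp a b (∑ i ∈ s, C (c i) * p i) = ∑ i ∈ s, C (c i) * jacobiOp a b (p i) := by
  simp only [jacobiOp, derivative_sum, derivative_C_mul, Finset.mul_sum, ← Finset.sum_add_distrib]
  refine Finset.sum_congr rfl fun i _ => ?_
  ring

/-- The action of the Jacobi operator on the basis `((x - 1) / 2) ^ m ((x + 1) / 2) ^ k`. -/
theorem jacobiOp_basis (a b : ℝ) (m k : ℕ) (x : ℝ) :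
    (jacobiOp a b ((C (1 / 2) * (X - 1)) ^ m * (C (1 / 2) * (X + 1)) ^ k)).eval x +
      (m + k) * (m + k + a + b + 1) * (((x - 1) / 2) ^ m * ((x + 1) / 2) ^ k) =
    (k * (k + b) + m * (m + a)) * (((x - 1) / 2) ^ m * ((x + 1) / 2) ^ k) -
      m * (m + a) * (((x - 1) / 2) ^ (m - 1) * ((x + 1) / 2) ^ (k + 1)) -
      k * (k + b) * (((x - 1) / 2) ^ (m + 1) * ((x + 1) / 2) ^ (k - 1)) := by
  -- Exponents 0 and 1 are separate because of the truncated subtractions and the exponents lowered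
  -- by two derivatives.
  rcases m with _ | _ | m <;> rcases k with _ | _ | k <;>
    simp [jacobiOp, derivative_pow] <;> ring

theorem realChoose_succ (r : ℝ) (k : ℕ) :
    realChoose r (k + 1) * (k + 1) = realChoose r k * (r - k) := by
  rw [realChoose, realChoose, descPochhammer_succ_right, Nat.factorial_succ]
  have : (k.factorial : ℝ) ≠ 0 := by positivity
  have : (k + 1 : ℝ) ≠ 0 := by positivity
  simp
  field_simp

theorem realChoose_pos {r : ℝ} {k : ℕ} (h : (k : ℝ) < r + 1) : 0 < realChoose r k := by
  induction k with
  | zero => simp [realChoose]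
  | succ k ih =>
    push_cast at h
    have h1 := ih (by linarith)
    have h2 := realChoose_succ r k
    have h3 : 0 < realChoose r k * (r - k) := mul_pos h1 (by linarith)
    rw [← h2] at h3
    exact (pos_iff_pos_of_mul_pos h3).2 (by positivity)

/-- In `jacobiOp_basis` the operator moves weight between neighbouring basis elements. This
recursion balances the two flows between k and k + 1, which makes the eigenvalue equation telescope.
-/
theorem jacobiCoeff_succ (a b : ℝ) {n k : ℕ} (hk : k < n) :
    realChoose (n + a) (k + 1) * realChoose (n + b) (n - (k + 1)) * ((k + 1) * (k + 1 + b)) =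
      realChoose (n + a) k * realChoose (n + b) (n - k) * ((n - k : ℕ) * ((n - k : ℕ) + a)) := by
  obtain ⟨m, rfl⟩ : ∃ m, n = k + 1 + m := Nat.exists_eq_add_of_lt hk |>.imp fun m h => by omega
  have e1 : k + 1 + m - (k + 1) = m := by omega
  have e2 : k + 1 + m - k = m + 1 := by omega
  rw [e1, e2]
  have h1 := realChoose_succ ((k + 1 + m : ℕ) + a) k
  have h2 := realChoose_succ ((k + 1 + m : ℕ) + b) m
  push_cast at h1 h2 ⊢
  linear_combination realChoose (k + 1 + m + b) m * (k + 1 + b) * h1 -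
    realChoose (k + 1 + m + a) k * (m + 1 + a) * h2

theorem jacobiOp_jacobiPolynomial (a b : ℝ) (n : ℕ) :
    jacobiOp a b (jacobiPolynomial a b n) = -C ((n : ℝ) * (n + a + b + 1)) *
      jacobiPolynomial a b n := by
  refine Polynomial.funext fun x => ?_
  rw [← sub_eq_zero, neg_mul, eval_neg, sub_neg_eq_add, jacobiPolynomial, jacobiOp_sum]
  simp only [eval_mul, eval_C, eval_finsetSum, Finset.mul_sum]
  rw [← Finset.sum_add_distrib]
  set c : ℕ → ℝ := fun k => realChoose (n + a) k * realChoose (n + b) (n - k) with hc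
  set e : ℕ → ℝ := fun k => c k * ((n - k : ℕ) * ((n - k : ℕ) + a)) with he
  set A := (x - 1) / 2 with hA
  set B := (x + 1) / 2 with hB
  have hce : ∀ k < n, c (k + 1) * ((k + 1) * (k + 1 + b)) = e k := fun k hk => jacobiCoeff_succ a b hk
  have step : ∀ k ∈ Finset.range (n + 1),
      c k * (jacobiOp a b ((C (1 / 2) * (X - 1)) ^ (n - k) * (C (1 / 2) * (X + 1)) ^ k)).eval x +
        n * (n + a + b + 1) * (c k * (((C (1 / 2) * (X - 1) : ℝ[X]) ^ (n - k)).eval x *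
          ((C (1 / 2) * (X + 1) : ℝ[X]) ^ k).eval x)) =
      c k * (k * (k + b)) * (A ^ (n - k) * B ^ k - A ^ (n - k + 1) * B ^ (k - 1)) +
      e k * (A ^ (n - k) * B ^ k - A ^ (n - k - 1) * B ^ (k + 1)) := by
    intro k hk
    have hk : k ≤ n := by
      have := Finset.mem_range.1 hk
      omega
    have h := jacobiOp_basis a b (n - k) k x
    rw [Nat.cast_sub hk] at h
    simp only [he, Nat.cast_sub hk, eval_pow, eval_mul, eval_C, eval_add, eval_sub, eval_X,
      eval_one]
    have h1 : 1 / 2 * (x - 1) = A := by rw [hA]; ring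
    have h2 : 1 / 2 * (x + 1) = B := by rw [hB]; ring
    rw [h1, h2]
    linear_combination c k * h
  -- The first sum loses its term k = 0 to the factor k, the second its term k = n to the factor n -
  -- k. After the index shift, the remaining terms cancel in pairs by `hce`.
  rw [Finset.sum_congr rfl step, Finset.sum_add_distrib, Finset.sum_range_succ', Finset.sum_range_succ
    (fun k => e k * _)]
  have hen : e n = 0 := by simp [he]
  rw [hen]
  simp only [Nat.cast_zero, zero_mul, mul_zero, add_zero]
  rw [← Finset.sum_add_distrib]
  refine Finset.sum_eq_zero fun k hk => ?_
  have hk := Finset.mem_range.1 hk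
  push_cast
  rw [hce k hk, show n - (k + 1) = n - k - 1 by omega, show n - k - 1 + 1 = n - k by omega]
  ring

theorem natDegree_jacobiPolynomial_le (a b : ℝ) (n : ℕ) :
    (jacobiPolynomial a b n).natDegree ≤ n := by
  refine natDegree_sum_le_of_forall_le _ _ fun k hk => ?_
  have hk := Finset.mem_range.1 hk
  refine (natDegree_C_mul_le _ _).trans (natDegree_mul_le.trans ?_)
  have h1 : (C (1 / 2 : ℝ) * (X - 1)).natDegree ≤ 1 :=
    (natDegree_C_mul_le _ _).trans (by simpa using natDegree_X_sub_C_le (1 : ℝ))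
  have h2 : (C (1 / 2 : ℝ) * (X + 1)).natDegree ≤ 1 :=
    (natDegree_C_mul_le _ _).trans (by simpa using (natDegree_X_add_C (1 : ℝ)).le)
  have := natDegree_pow_le_of_le (n - k) h1
  have := natDegree_pow_le_of_le k h2
  omega

theorem jacobiP_one_pos {a : ℝ} (b : ℝ) (ha : -1 < a) (n : ℕ) : 0 < jacobiP a b n 1 := by
  rw [jacobiP, Finset.sum_eq_single n]
  · simp only [Nat.sub_self, pow_zero, mul_one]
    have h1 : 0 < realChoose (n + a) n := realChoose_pos (by linarith)
    have h2 : realChoose (n + b) 0 = 1 := by simp [realChoose]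
    rw [h2]
    norm_num
    exact h1
  · intro k hk hkn
    have : n - k ≠ 0 := by
      have := Finset.mem_range.1 hk
      omega
    simp [this]
  · simp

theorem jacobiPolynomial_ne_zero {a : ℝ} (b : ℝ) (ha : -1 < a) (n : ℕ) :
    jacobiPolynomial a b n ≠ 0 := by
  intro h
  have := jacobiP_one_pos b ha n
  rw [← jacobiPolynomial_eval, h] at this
  simp at this

/-- The eigenvalue `n (n + a + b + 1)`. -/
noncomputable def jacobiEig (a b : ℝ) (n : ℕ) : ℝ := (n : ℝ) * (n + a + b + 1)

theorem jacobiEig_strictMono {a b : ℝ} (h : 0 < a + b + 1) : StrictMono (jacobiEig a b) := by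
  refine strictMono_nat_of_lt_succ fun n => ?_
  simp only [jacobiEig]
  have : (0 : ℝ) ≤ n := by positivity
  push_cast
  nlinarith

/-- The coefficient of `x ^ N` in `jacobiOp a b p`, for `p` of degree at most `N`. -/
theorem coeff_jacobiOp {a b : ℝ} {p : ℝ[X]} {N : ℕ} (hp : p.natDegree ≤ N) :
    (jacobiOp a b p).coeff N = -jacobiEig a b N * p.coeff N := by
  have h1 : p.coeff (N + 1) = 0 := coeff_eq_zero_of_natDegree_lt (by omega)
  have h2 : p.coeff (N + 2) = 0 := coeff_eq_zero_of_natDegree_lt (by omega)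
  have e : jacobiOp a b p = derivative (derivative p) - derivative (derivative p) * X ^ 2 +
      (C (b - a) * derivative p - C (a + b + 2) * (derivative p * X)) := by
    rw [jacobiOp]; ring
  rw [e, jacobiEig, coeff_add, coeff_sub, coeff_sub, coeff_C_mul, coeff_C_mul, coeff_mul_X_pow']
  rcases N with _ | _ | N <;> simp [coeff_derivative, h1, h2, coeff_mul_X] <;> ring

/-- No leading coefficient has to be computed: if N is the true degree, comparing the coefficients
of X^N in the eigenvalue equation gives equal eigenvalues for N and n, and these are injective in
the index. -/
theorem degree_jacobiPolynomial {a b : ℝ} (ha : -1 < a) (h : 0 < a + b + 1) (n : ℕ) :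
    (jacobiPolynomial a b n).degree = n := by
  set p := jacobiPolynomial a b n with hp
  have h0 : p ≠ 0 := jacobiPolynomial_ne_zero b ha n
  have h1 := coeff_jacobiOp (a := a) (b := b) (le_refl p.natDegree)
  rw [hp, jacobiOp_jacobiPolynomial, ← hp, ← C_neg, coeff_C_mul] at h1
  have h2 : p.coeff p.natDegree ≠ 0 := by simpa using h0
  have h3 := mul_right_cancel₀ h2 h1
  have h4 := (jacobiEig_strictMono h).injective (neg_injective h3)
  rw [degree_eq_natDegree h0, ← h4]

/-- The Jacobi polynomials span all polynomials. -/
theorem span_jacobiPolynomial {a b : ℝ} (ha : -1 < a) (h : 0 < a + b + 1) :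
    Submodule.span ℝ (Set.range (jacobiPolynomial a b)) = ⊤ := by
  let S : Polynomial.Sequence ℝ := ⟨jacobiPolynomial a b, degree_jacobiPolynomial ha h⟩
  exact S.span fun i => (leadingCoeff_ne_zero.2 (S.ne_zero i)).isUnit

/-- Differentiation maps solutions of the Jacobi equation to solutions with shifted parameters. -/
theorem jacobiOp_derivative {a b : ℝ} {n : ℕ} {p : ℝ[X]}
    (h : jacobiOp a b p = -C (jacobiEig a b (n + 1)) * p) :
    jacobiOp (a + 1) (b + 1) (derivative p) =
      -C (jacobiEig (a + 1) (b + 1) n) * derivative p := by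
  have h1 := congrArg derivative h
  rw [jacobiOp, neg_mul, derivative_neg, derivative_C_mul] at h1
  refine Polynomial.funext fun x => ?_
  have h2 := congrArg (eval x) h1
  simp [jacobiOp, jacobiEig] at h2 ⊢
  linear_combination h2

end JacobiODE

/-! ### The Jacobi weight, integration by parts, and a sup norm bound. -/

section JacobiWeight

/-- The unnormalized Jacobi weight `(1 - x) ^ a (1 + x) ^ b`. -/
noncomputable def jacobiWeight (a b x : ℝ) : ℝ := (1 - x) ^ a * (1 + x) ^ b

theorem jacobiWeight_nonneg (a b : ℝ) {x : ℝ} (hx : x ∈ Icc (-1 : ℝ) 1) : 0 ≤ jacobiWeight a b x :=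
  mul_nonneg (Real.rpow_nonneg (by linarith [hx.2]) _) (Real.rpow_nonneg (by linarith [hx.1]) _)

theorem jacobiWeight_pos (a b : ℝ) {x : ℝ} (hx : x ∈ Ioo (-1 : ℝ) 1) : 0 < jacobiWeight a b x :=
  mul_pos (Real.rpow_pos_of_pos (by linarith [hx.2]) _) (Real.rpow_pos_of_pos (by linarith [hx.1]) _)

theorem jacobiWeight_add_one (a b : ℝ) {x : ℝ} (hx : x ∈ Ioo (-1 : ℝ) 1) :
    jacobiWeight (a + 1) (b + 1) x = jacobiWeight a b x * (1 - x ^ 2) := by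
  have h1 : 0 < 1 - x := by linarith [hx.2]
  have h2 : 0 < 1 + x := by linarith [hx.1]
  rw [jacobiWeight, jacobiWeight, Real.rpow_add_one h1.ne', Real.rpow_add_one h2.ne']
  ring

theorem measurable_jacobiWeight (a b : ℝ) : Measurable (jacobiWeight a b) := by
  unfold jacobiWeight
  fun_prop

theorem continuous_jacobiWeight {a b : ℝ} (ha : 0 ≤ a) (hb : 0 ≤ b) :
    Continuous (jacobiWeight a b) :=
  ((continuous_const.sub continuous_id).rpow_const fun _ => Or.inr ha).mul
    ((continuous_const.add continuous_id).rpow_const fun _ => Or.inr hb)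

theorem hasDerivAt_jacobiWeight_add_one (a b : ℝ) {x : ℝ} (hx : x ∈ Ioo (-1 : ℝ) 1) :
    HasDerivAt (jacobiWeight (a + 1) (b + 1))
      (jacobiWeight a b x * (b - a - (a + b + 2) * x)) x := by
  have h1 : 0 < 1 - x := by linarith [hx.2]
  have h2 : 0 < 1 + x := by linarith [hx.1]
  have d1 : HasDerivAt (fun y : ℝ => (1 - y) ^ (a + 1)) (-1 * (a + 1) * (1 - x) ^ (a + 1 - 1)) x :=
    ((hasDerivAt_id x).const_sub 1).rpow_const (Or.inl h1.ne')
  have d2 : HasDerivAt (fun y : ℝ => (1 + y) ^ (b + 1)) (1 * (b + 1) * (1 + x) ^ (b + 1 - 1)) x :=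
    ((hasDerivAt_id x).const_add 1).rpow_const (Or.inl h2.ne')
  refine (d1.mul d2).congr_deriv ?_
  rw [jacobiWeight, add_sub_cancel_right, add_sub_cancel_right, Real.rpow_add_one h1.ne',
    Real.rpow_add_one h2.ne']
  ring

theorem intervalIntegrable_jacobiWeight {a b : ℝ} (ha : -1 < a) (hb : -1 < b) :
    IntervalIntegrable (jacobiWeight a b) volume (-1) 1 := by
  have key : ∀ {a b : ℝ}, -1 < b → IntervalIntegrable (jacobiWeight a b) volume (-1) 0 := by
    intro a b hb
    have h1 : IntervalIntegrable (fun x : ℝ => (1 + x) ^ b) volume (-1) 0 := by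
      have := (intervalIntegral.intervalIntegrable_rpow' (a := 0) (b := 1) hb).comp_add_left 1
      simpa using this
    refine h1.continuousOn_mul fun x hx => ?_
    rw [uIcc_of_le (by norm_num)] at hx
    exact ((continuousAt_const.sub continuousAt_id).rpow_const
      (Or.inl (by simp; linarith [hx.2]))).continuousWithinAt
  refine (key hb).trans ?_
  -- The reflection x ↦ -x exchanges the two exponents, so the half next to 1 reduces to the half
  -- next to -1.
  have h := (key (a := b) ha).comp_sub_left 0
  simp only [sub_neg_eq_add, zero_add, sub_zero] at h
  refine h.symm.congr fun x _ => ?_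
  simp only [jacobiWeight, zero_sub, sub_neg_eq_add, ← sub_eq_add_neg]
  ring

theorem intervalIntegrable_jacobiWeight_mul {a b : ℝ} (ha : -1 < a) (hb : -1 < b) {g : ℝ → ℝ}
    (hg : ContinuousOn g (Icc (-1) 1)) :
    IntervalIntegrable (fun x => jacobiWeight a b x * g x) volume (-1) 1 :=
  (intervalIntegrable_jacobiWeight ha hb).mul_continuousOn (by rwa [uIcc_of_le (by norm_num)])

/-- The normalizing constant of the Jacobi measure. -/
noncomputable def jacobiMass (a b : ℝ) : ℝ :=
  2 ^ (a + b + 1) * ProbabilityTheory.beta (a + 1) (b + 1)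

theorem jacobiMass_pos {a b : ℝ} (ha : -1 < a) (hb : -1 < b) : 0 < jacobiMass a b :=
  mul_pos (Real.rpow_pos_of_pos two_pos _)
    (ProbabilityTheory.beta_pos (by linarith) (by linarith))

theorem jacobiMeasure_eq (a b : ℝ) : jacobiMeasure a b =
    (volume.restrict (Icc (-1) 1)).withDensity fun x =>
      ENNReal.ofReal (jacobiWeight a b x / jacobiMass a b) := rfl

theorem ae_mem_jacobiMeasure (a b : ℝ) : ∀ᵐ x ∂(jacobiMeasure a b), x ∈ Icc (-1 : ℝ) 1 :=
  (withDensity_absolutelyContinuous _ _).ae_le (ae_restrict_mem measurableSet_Icc)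

theorem integrableOn_jacobiWeight {a b : ℝ} (ha : -1 < a) (hb : -1 < b) :
    IntegrableOn (jacobiWeight a b) (Icc (-1) 1) := by
  have := intervalIntegrable_jacobiWeight ha hb
  rwa [intervalIntegrable_iff_integrableOn_Icc_of_le (by norm_num)] at this

theorem isFiniteMeasure_jacobiMeasure {a b : ℝ} (ha : -1 < a) (hb : -1 < b) :
    IsFiniteMeasure (jacobiMeasure a b) :=
  isFiniteMeasure_withDensity_ofReal ((integrableOn_jacobiWeight ha hb).div_const _).2

theorem integral_jacobiMeasure {a b : ℝ} (ha : -1 < a) (hb : -1 < b) (g : ℝ → ℝ) :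
    ∫ x, g x ∂(jacobiMeasure a b) =
      (jacobiMass a b)⁻¹ * ∫ x in (-1)..1, jacobiWeight a b x * g x := by
  rw [jacobiMeasure_eq, integral_withDensity_eq_integral_toReal_smul
    ((measurable_jacobiWeight a b).div_const _).ennreal_ofReal (by simp),
    intervalIntegral.integral_of_le (by norm_num), ← integral_Icc_eq_integral_Ioc,
    ← integral_const_mul]
  refine setIntegral_congr_fun measurableSet_Icc fun x hx => ?_
  simp only [smul_eq_mul]
  rw [ENNReal.toReal_ofReal (div_nonneg (jacobiWeight_nonneg a b hx) (jacobiMass_pos ha hb).le)]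
  ring

theorem integrable_jacobiMeasure {a b : ℝ} (ha : -1 < a) (hb : -1 < b) {g : ℝ → ℝ}
    (hg : ContinuousOn g (Icc (-1) 1)) : Integrable g (jacobiMeasure a b) := by
  have := isFiniteMeasure_jacobiMeasure ha hb
  have h : (jacobiMeasure a b).restrict (Icc (-1) 1) = jacobiMeasure a b :=
    Measure.restrict_eq_self_of_ae_mem (ae_mem_jacobiMeasure a b)
  rw [← h]
  exact hg.integrableOn_compact isCompact_Icc

theorem integral_jacobiWeight_pos {a b : ℝ} (ha : -1 < a) (hb : -1 < b) :
    0 < ∫ x in (-1)..1, jacobiWeight a b x :=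
  intervalIntegral.intervalIntegral_pos_of_pos_on (intervalIntegrable_jacobiWeight ha hb)
    (fun _ hx => jacobiWeight_pos a b hx) (by norm_num)

/-- The finitely many roots form a null set, so a vanishing integral would force the measure itself
to vanish, against its positive mass. -/
theorem integral_sq_polynomial_pos {a b : ℝ} (ha : -1 < a) (hb : -1 < b) {p : Polynomial ℝ}
    (hp : p ≠ 0) : 0 < ∫ x, p.eval x ^ 2 ∂(jacobiMeasure a b) := by
  have hfin := isFiniteMeasure_jacobiMeasure ha hb
  refine lt_of_le_of_ne (integral_nonneg fun x => sq_nonneg _) fun h => ?_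
  have hi : Integrable (fun x => p.eval x ^ 2) (jacobiMeasure a b) :=
    integrable_jacobiMeasure ha hb (p.continuous.pow 2).continuousOn
  have h0 := (integral_eq_zero_iff_of_nonneg (fun x => sq_nonneg (p.eval x)) hi).1 h.symm
  have hac : jacobiMeasure a b ≪ volume :=
    (withDensity_absolutelyContinuous _ _).trans Measure.absolutelyContinuous_restrict
  have hroots : ∀ᵐ x ∂(jacobiMeasure a b), x ∉ (p.roots.toFinset : Set ℝ) :=
    hac.ae_le (measure_eq_zero_iff_ae_notMem.1 (Finset.measure_zero _ _))
  have hF : ∀ᵐ x ∂(jacobiMeasure a b), False := by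
    filter_upwards [h0, hroots] with x h1 h2
    exact h2 (by simpa [hp] using h1)
  have h1 : ∫ _, (1 : ℝ) ∂(jacobiMeasure a b) = 0 :=
    integral_eq_zero_of_ae (hF.mono fun _ h => h.elim)
  rw [integral_jacobiMeasure ha hb] at h1
  have h2 := integral_jacobiWeight_pos ha hb
  have h3 := jacobiMass_pos ha hb
  simp only [mul_one] at h1
  have := mul_pos (inv_pos.2 h3) h2
  linarith

/-- The one-dimensional Jacobi operator evaluated from the derivatives at a point. -/
noncomputable def jacobiDiff (a b x g' g'' : ℝ) : ℝ :=
  (1 - x ^ 2) * g'' + (b - a - (a + b + 2) * x) * g'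

theorem eval_jacobiOp (a b x : ℝ) (p : Polynomial ℝ) : (jacobiOp a b p).eval x =
    jacobiDiff a b x (p.derivative.eval x) (p.derivative.derivative.eval x) := by
  simp [jacobiOp, jacobiDiff]

/-- Integration by parts for the Jacobi operator. -/
theorem integral_jacobiDiff_mul {a b : ℝ} (ha : -1 < a) (hb : -1 < b) {g' g'' h h' : ℝ → ℝ}
    (hg' : ContinuousOn g' (Icc (-1) 1)) (hg'' : ContinuousOn g'' (Icc (-1) 1))
    (hh : ContinuousOn h (Icc (-1) 1)) (hh' : ContinuousOn h' (Icc (-1) 1))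
    (dg : ∀ x ∈ Ioo (-1 : ℝ) 1, HasDerivAt g' (g'' x) x)
    (dh : ∀ x ∈ Ioo (-1 : ℝ) 1, HasDerivAt h (h' x) x) :
    ∫ x in (-1)..1, jacobiWeight a b x * (jacobiDiff a b x (g' x) (g'' x) * h x) =
      -∫ x in (-1)..1, jacobiWeight (a + 1) (b + 1) x * (g' x * h' x) := by
  have hL : ContinuousOn (fun x => jacobiDiff a b x (g' x) (g'' x) * h x) (Icc (-1) 1) := by
    unfold jacobiDiff
    fun_prop
  have i1 := intervalIntegrable_jacobiWeight_mul ha hb hL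
  have i2 := intervalIntegrable_jacobiWeight_mul (a := a + 1) (b := b + 1) (by linarith)
    (by linarith) (g := fun x => g' x * h' x) (hg'.mul hh')
  have hw : Continuous (jacobiWeight (a + 1) (b + 1)) :=
    continuous_jacobiWeight (by linarith) (by linarith)
  -- In divergence form, the raised weight times g' has derivative weight times the Jacobi operator
  -- of g. The boundary terms vanish because a + 1 and b + 1 are positive.
  have key := intervalIntegral.integral_eq_sub_of_hasDerivAt_of_le (a := -1) (b := 1)
    (f := fun x => jacobiWeight (a + 1) (b + 1) x * (g' x * h x))
    (f' := fun x => jacobiWeight a b x * (jacobiDiff a b x (g' x) (g'' x) * h x) +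
      jacobiWeight (a + 1) (b + 1) x * (g' x * h' x)) (by norm_num)
    (hw.continuousOn.mul (hg'.mul hh)) (fun x hx => by
      refine ((hasDerivAt_jacobiWeight_add_one a b hx).mul ((dg x hx).mul (dh x hx))).congr_deriv ?_
      rw [jacobiWeight_add_one a b hx, jacobiDiff, Pi.mul_apply]
      ring) (i1.add i2)
  rw [intervalIntegral.integral_add i1 i2] at key
  have e1 : jacobiWeight (a + 1) (b + 1) 1 = 0 := by
    simp [jacobiWeight, Real.zero_rpow (show a + 1 ≠ 0 by linarith)]
  have e2 : jacobiWeight (a + 1) (b + 1) (-1) = 0 := by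
    simp [jacobiWeight, Real.zero_rpow (show b + 1 ≠ 0 by linarith)]
  simp only [e1, e2, zero_mul, sub_zero] at key
  linarith

/-- Symmetry of the Jacobi operator. -/
theorem integral_jacobiDiff_mul_comm {a b : ℝ} (ha : -1 < a) (hb : -1 < b)
    {g g' g'' h h' h'' : ℝ → ℝ}
    (hg : ContinuousOn g (Icc (-1) 1))
    (hg' : ContinuousOn g' (Icc (-1) 1)) (hg'' : ContinuousOn g'' (Icc (-1) 1))
    (hh : ContinuousOn h (Icc (-1) 1)) (hh' : ContinuousOn h' (Icc (-1) 1))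
    (hh'' : ContinuousOn h'' (Icc (-1) 1))
    (dg : ∀ x ∈ Ioo (-1 : ℝ) 1, HasDerivAt g (g' x) x)
    (dg' : ∀ x ∈ Ioo (-1 : ℝ) 1, HasDerivAt g' (g'' x) x)
    (dh : ∀ x ∈ Ioo (-1 : ℝ) 1, HasDerivAt h (h' x) x)
    (dh' : ∀ x ∈ Ioo (-1 : ℝ) 1, HasDerivAt h' (h'' x) x) :
    ∫ x, jacobiDiff a b x (g' x) (g'' x) * h x ∂(jacobiMeasure a b) =
      ∫ x, g x * jacobiDiff a b x (h' x) (h'' x) ∂(jacobiMeasure a b) := by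
  have h1 := integral_jacobiDiff_mul ha hb hg' hg'' hh hh' dg' dh
  have h2 := integral_jacobiDiff_mul ha hb hh' hh'' hg hg' dh' dg
  simp only [integral_jacobiMeasure ha hb, h1, mul_comm (g _), h2, mul_comm (h' _)]

theorem integral_jacobiOp_mul {a b : ℝ} (ha : -1 < a) (hb : -1 < b) (p q : Polynomial ℝ) :
    ∫ x in (-1)..1, jacobiWeight a b x * ((jacobiOp a b p).eval x * q.eval x) =
      -∫ x in (-1)..1, jacobiWeight (a + 1) (b + 1) x *
        (p.derivative.eval x * q.derivative.eval x) := by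
  simp only [eval_jacobiOp]
  exact integral_jacobiDiff_mul ha hb p.derivative.continuous.continuousOn
    p.derivative.derivative.continuous.continuousOn q.continuous.continuousOn
    q.derivative.continuous.continuousOn (fun x _ => p.derivative.hasDerivAt x)
    (fun x _ => q.hasDerivAt x)

/-- An eigenfunction bound: the sup norm of a polynomial solution of the Jacobi equation
is controlled by its `L²` norm. -/
theorem sq_eval_mul_le_of_jacobiOp {n : ℕ} : ∀ {a b : ℝ} {p : Polynomial ℝ} {Q : ℝ}, -1 < a →
    -1 < b → 0 < a + b + 1 → p.natDegree ≤ n →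
    jacobiOp a b p = -Polynomial.C (jacobiEig a b n) * p →
    4 * (n * (2 * n + a + b + 1)) ≤ Q → ∀ x ∈ Icc (-1 : ℝ) 1,
    p.eval x ^ 2 * ∫ y in (-1)..1, jacobiWeight (a + n) (b + n) y ≤
      Q ^ n * ∫ y in (-1)..1, jacobiWeight a b y * (p.eval y * p.eval y) := by
  induction n with
  | zero =>
    intro a b p Q ha hb hab hdeg _ _ x _
    rw [Polynomial.eq_C_of_natDegree_le_zero hdeg]
    simp only [Polynomial.eval_C, intervalIntegral.integral_mul_const, Nat.cast_zero, add_zero,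
      pow_zero, one_mul]
    apply le_of_eq
    ring
  | succ n ih =>
    intro a b p Q ha hb hab hdeg hode hQ x hx
    have hn : (0 : ℝ) ≤ n := by positivity
    push_cast at hQ
    have hlam : 0 < jacobiEig a b (n + 1) := by
      rw [jacobiEig]; push_cast; exact mul_pos (by linarith) (by linarith)
    have hlamQ : 4 * jacobiEig a b (n + 1) ≤ Q := by
      rw [jacobiEig]; push_cast; nlinarith
    have hQ0 : 0 ≤ Q := by linarith
    have hode' : ∀ y, (jacobiOp a b p).eval y = -jacobiEig a b (n + 1) * p.eval y := by
      intro y; rw [hode]; simp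
    -- Energy identity: the weighted L² norm of p' for the shifted parameters is the eigenvalue
    -- times that of p.
    have e1 := integral_jacobiOp_mul ha hb p p
    simp only [hode', neg_mul, mul_neg, intervalIntegral.integral_neg, neg_inj,
      mul_assoc, mul_left_comm _ (jacobiEig a b (n + 1)),
      intervalIntegral.integral_const_mul] at e1
    -- Passing from (n + 1, a, b) to (n, a + 1, b + 1) preserves the value of 2n + a + b + 1 and
    -- lowers the factor in front of it, so one Q serves the whole induction.
    have hih := ih (a := a + 1) (b := b + 1) (p := p.derivative) (Q := Q) (by linarith)
      (by linarith) (by linarith)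
      ((Polynomial.natDegree_derivative_le p).trans (by omega)) (jacobiOp_derivative hode)
      (by nlinarith)
    -- Testing the equation against 1 shows that p has weighted mean zero, so it cannot keep one
    -- strict sign.
    obtain ⟨z, hz, hpz⟩ : ∃ z ∈ Icc (-1 : ℝ) 1, p.eval z = 0 := by
      by_contra! hne
      have e2 := integral_jacobiOp_mul ha hb p 1
      simp only [hode', neg_mul, mul_neg, intervalIntegral.integral_neg, neg_inj,
        mul_left_comm _ (jacobiEig a b (n + 1)), Polynomial.eval_one, mul_one,
        Polynomial.derivative_one, Polynomial.eval_zero, mul_zero, intervalIntegral.integral_zero,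
        intervalIntegral.integral_const_mul, mul_eq_zero, hlam.ne', false_or] at e2
      have hsign : (∀ y ∈ Icc (-1 : ℝ) 1, 0 < p.eval y) ∨ (∀ y ∈ Icc (-1 : ℝ) 1, p.eval y < 0) := by
        by_contra! hcon
        obtain ⟨⟨u, hu, hu'⟩, v, hv, hv'⟩ := hcon
        obtain ⟨z, hz, hz'⟩ := isPreconnected_Icc.intermediate_value hu hv
          p.continuous.continuousOn ⟨hu', hv'⟩
        exact hne z hz hz'
      have hI := intervalIntegrable_jacobiWeight_mul ha hb p.continuous.continuousOn
      rcases hsign with hs | hs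
      · have := intervalIntegral.intervalIntegral_pos_of_pos_on hI
          (fun y hy => mul_pos (jacobiWeight_pos a b hy) (hs y (Ioo_subset_Icc_self hy)))
          (by norm_num)
        linarith
      · have := intervalIntegral.intervalIntegral_pos_of_pos_on hI.neg
          (fun y hy => by
            have := mul_neg_of_pos_of_neg (jacobiWeight_pos a b hy) (hs y (Ioo_subset_Icc_self hy))
            simpa using this)
          (by norm_num)
        simp only [Pi.neg_apply, intervalIntegral.integral_neg] at this
        linarith
    -- Mean value theorem between x and the zero z; the 4 is the squared length of [-1, 1].
    obtain ⟨y, hy, hxy⟩ : ∃ y ∈ Icc (-1 : ℝ) 1, p.eval x ^ 2 ≤ 4 * p.derivative.eval y ^ 2 := by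
      have aux : ∀ u ∈ Icc (-1 : ℝ) 1, ∀ v ∈ Icc (-1 : ℝ) 1, u < v →
          ∃ y ∈ Icc (-1 : ℝ) 1, (p.eval v - p.eval u) ^ 2 ≤ 4 * p.derivative.eval y ^ 2 := by
        intro u hu v hv huv
        obtain ⟨y, hy, hy'⟩ := exists_hasDerivAt_eq_slope (fun x => p.eval x)
          (fun x => p.derivative.eval x) huv p.continuous.continuousOn (fun x _ => p.hasDerivAt x)
        refine ⟨y, ⟨by linarith [hu.1, hy.1], by linarith [hv.2, hy.2]⟩, ?_⟩
        rw [eq_div_iff (by linarith)] at hy'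
        rw [← hy', mul_pow, mul_comm]
        have : (v - u) ^ 2 ≤ 4 := by nlinarith [hu.1, hv.2]
        exact mul_le_mul_of_nonneg_right this (sq_nonneg _)
      rcases lt_trichotomy x z with h | h | h
      · obtain ⟨y, hy, h'⟩ := aux x hx z hz h
        exact ⟨y, hy, by simpa [hpz] using h'⟩
      · exact ⟨x, hx, by rw [h, hpz]; nlinarith [sq_nonneg (p.derivative.eval z)]⟩
      · obtain ⟨y, hy, h'⟩ := aux z hz x hx h
        exact ⟨y, hy, by simpa [hpz] using h'⟩
    have hih := hih y hy
    rw [← e1] at hih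
    push_cast
    rw [show a + (n + 1) = a + 1 + (n : ℝ) by ring, show b + (n + 1) = b + 1 + (n : ℝ) by ring]
    set J := ∫ y in (-1)..1, jacobiWeight (a + 1 + n) (b + 1 + n) y
    have hJ : 0 < J := integral_jacobiWeight_pos (by linarith) (by linarith)
    set I := ∫ y in (-1)..1, jacobiWeight a b y * (p.eval y * p.eval y)
    have hI : 0 ≤ I := intervalIntegral.integral_nonneg (by norm_num) fun y hy =>
      mul_nonneg (jacobiWeight_nonneg a b hy) (mul_self_nonneg _)
    calc p.eval x ^ 2 * J ≤ 4 * p.derivative.eval y ^ 2 * J := by gcongr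
      _ = 4 * (p.derivative.eval y ^ 2 * J) := by ring
      _ ≤ 4 * (Q ^ n * (jacobiEig a b (n + 1) * I)) := by gcongr
      _ = 4 * jacobiEig a b (n + 1) * (Q ^ n * I) := by ring
      _ ≤ Q * (Q ^ n * I) := by gcongr
      _ = Q ^ (n + 1) * I := by ring

end JacobiWeight

/-! ### Orthonormality and growth of the normalized polynomials. -/

section JacobiNormalized

open Polynomial

/-- The normalized Jacobi polynomial as an element of `ℝ[X]`. -/
noncomputable def jacobiPhi (a b : ℝ) (n : ℕ) : ℝ[X] :=
  C (√(∫ y, jacobiP a b n y ^ 2 ∂(jacobiMeasure a b)))⁻¹ * jacobiPolynomial a b n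

theorem jacobiPhi_eval (a b : ℝ) (n : ℕ) (x : ℝ) :
    (jacobiPhi a b n).eval x = jacobiPNormalized a b n x := by
  rw [jacobiPhi, eval_mul, eval_C, jacobiPolynomial_eval, jacobiPNormalized]
  ring

theorem jacobiP_norm_pos {a b : ℝ} (ha : -1 < a) (hb : -1 < b) (n : ℕ) :
    0 < √(∫ y, jacobiP a b n y ^ 2 ∂(jacobiMeasure a b)) := by
  refine Real.sqrt_pos.2 ?_
  simp only [← jacobiPolynomial_eval]
  exact integral_sq_polynomial_pos ha hb (jacobiPolynomial_ne_zero b ha n)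

theorem natDegree_jacobiPhi_le (a b : ℝ) (n : ℕ) : (jacobiPhi a b n).natDegree ≤ n :=
  (natDegree_C_mul_le _ _).trans (natDegree_jacobiPolynomial_le a b n)

theorem jacobiOp_jacobiPhi (a b : ℝ) (n : ℕ) :
    jacobiOp a b (jacobiPhi a b n) = -C (jacobiEig a b n) * jacobiPhi a b n := by
  have h := jacobiOp_sum a b {0} (fun _ => (√(∫ y, jacobiP a b n y ^ 2 ∂(jacobiMeasure a b)))⁻¹)
    (fun _ => jacobiPolynomial a b n)
  simp only [Finset.sum_singleton] at h
  rw [jacobiPhi, h, jacobiOp_jacobiPolynomial, jacobiEig]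
  ring

theorem jacobiDiff_jacobiPhi (a b : ℝ) (n : ℕ) (x : ℝ) :
    jacobiDiff a b x ((jacobiPhi a b n).derivative.eval x)
      ((jacobiPhi a b n).derivative.derivative.eval x) =
      -(jacobiEig a b n * (jacobiPhi a b n).eval x) := by
  rw [← eval_jacobiOp, jacobiOp_jacobiPhi]
  simp

theorem span_jacobiPhi {a b : ℝ} (ha : -1 < a) (hb : -1 < b) (h : 0 < a + b + 1) :
    Submodule.span ℝ (Set.range (jacobiPhi a b)) = ⊤ := by
  rw [eq_top_iff, ← span_jacobiPolynomial ha h, Submodule.span_le]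
  rintro _ ⟨n, rfl⟩
  have h0 := (jacobiP_norm_pos ha hb n).ne'
  have e : jacobiPolynomial a b n =
      √(∫ y, jacobiP a b n y ^ 2 ∂(jacobiMeasure a b)) • jacobiPhi a b n := by
    rw [jacobiPhi, smul_eq_C_mul, ← mul_assoc, ← C_mul, mul_inv_cancel₀ h0, C_1, one_mul]
  rw [e]
  exact Submodule.smul_mem _ _ (Submodule.subset_span ⟨n, rfl⟩)

/-- Testing the Jacobi operator of a twice differentiable function against an eigenfunction. -/
theorem integral_jacobiDiff_mul_jacobiPhi {a b : ℝ} (ha : -1 < a) (hb : -1 < b) (n : ℕ)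
    {g g' g'' : ℝ → ℝ} (hg : ContinuousOn g (Icc (-1) 1))
    (hg' : ContinuousOn g' (Icc (-1) 1)) (hg'' : ContinuousOn g'' (Icc (-1) 1))
    (dg : ∀ x ∈ Ioo (-1 : ℝ) 1, HasDerivAt g (g' x) x)
    (dg' : ∀ x ∈ Ioo (-1 : ℝ) 1, HasDerivAt g' (g'' x) x) :
    ∫ x, jacobiDiff a b x (g' x) (g'' x) * (jacobiPhi a b n).eval x ∂(jacobiMeasure a b) =
      -jacobiEig a b n * ∫ x, g x * (jacobiPhi a b n).eval x ∂(jacobiMeasure a b) := by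
  set p := jacobiPhi a b n with hp
  rw [integral_jacobiDiff_mul_comm ha hb hg hg' hg'' p.continuous.continuousOn
    p.derivative.continuous.continuousOn p.derivative.derivative.continuous.continuousOn
    dg dg' (fun x _ => p.hasDerivAt x) (fun x _ => p.derivative.hasDerivAt x),
    ← integral_const_mul]
  simp only [hp, jacobiDiff_jacobiPhi]
  congr 1
  ext x
  ring

/-- Off the diagonal, symmetry of the operator makes the integral a multiple of itself with two
distinct eigenvalues. -/
theorem integral_jacobiPhi_mul {a b : ℝ} (ha : -1 < a) (hb : -1 < b) (h : 0 < a + b + 1)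
    (m n : ℕ) : ∫ x, (jacobiPhi a b m).eval x * (jacobiPhi a b n).eval x ∂(jacobiMeasure a b) =
      if m = n then 1 else 0 := by
  split_ifs with hmn
  · subst hmn
    have h0 := jacobiP_norm_pos ha hb m
    have h1 : 0 ≤ ∫ y, jacobiP a b m y ^ 2 ∂(jacobiMeasure a b) :=
      integral_nonneg fun y => sq_nonneg _
    have h2 : ∀ x, (jacobiPhi a b m).eval x * (jacobiPhi a b m).eval x =
        (∫ y, jacobiP a b m y ^ 2 ∂(jacobiMeasure a b))⁻¹ * jacobiP a b m x ^ 2 := by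
      intro x
      rw [jacobiPhi_eval, jacobiPNormalized, div_mul_div_comm, Real.mul_self_sqrt h1]
      ring
    simp only [h2]
    rw [integral_const_mul, inv_mul_cancel₀]
    exact (Real.sqrt_pos.1 h0).ne'
  · set p := jacobiPhi a b m with hp
    have h1 := integral_jacobiDiff_mul_jacobiPhi ha hb n p.continuous.continuousOn
      p.derivative.continuous.continuousOn p.derivative.derivative.continuous.continuousOn
      (fun x _ => p.hasDerivAt x) (fun x _ => p.derivative.hasDerivAt x)
    simp only [hp, jacobiDiff_jacobiPhi, neg_mul, mul_assoc, integral_neg, integral_const_mul] at h1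
    have h2 : jacobiEig a b m ≠ jacobiEig a b n := fun e => hmn ((jacobiEig_strictMono h).injective e)
    have h3 : (jacobiEig a b m - jacobiEig a b n) *
      ∫ x, (jacobiPhi a b m).eval x * (jacobiPhi a b n).eval x ∂(jacobiMeasure a b) = 0 := by
      linarith
    exact (mul_eq_zero.1 h3).resolve_left (sub_ne_zero.2 h2)

theorem jacobiWeight_add_nat (a b : ℝ) (n : ℕ) {x : ℝ} (hx : x ∈ Ioo (-1 : ℝ) 1) :
    jacobiWeight (a + n) (b + n) x = jacobiWeight a b x * (1 - x ^ 2) ^ n := by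
  have h1 : 0 < 1 - x := by linarith [hx.2]
  have h2 : 0 < 1 + x := by linarith [hx.1]
  rw [jacobiWeight, jacobiWeight, Real.rpow_add_natCast h1.ne', Real.rpow_add_natCast h2.ne',
    show 1 - x ^ 2 = (1 - x) * (1 + x) by ring, mul_pow]
  ring

/-- On [-1/2, 1/2] one has 1 - x² ≥ 3/4, so raising the parameters by n costs at most a geometric
factor. -/
theorem exists_le_integral_jacobiWeight {a b : ℝ} (ha : -1 < a) (hb : -1 < b) :
    ∃ J : ℝ, 0 < J ∧ ∀ n : ℕ,
      (3 / 4) ^ n * J ≤ ∫ x in (-1)..1, jacobiWeight (a + n) (b + n) x := by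
  have hsub : uIcc (-(1 / 2) : ℝ) (1 / 2) ⊆ uIcc (-1) 1 := by
    rw [uIcc_of_le (by norm_num), uIcc_of_le (by norm_num)]
    exact Icc_subset_Icc (by norm_num) (by norm_num)
  have hI : IntervalIntegrable (jacobiWeight a b) volume (-(1 / 2)) (1 / 2) :=
    (intervalIntegrable_jacobiWeight ha hb).mono_set hsub
  refine ⟨∫ x in (-(1 / 2))..(1 / 2), jacobiWeight a b x,
    intervalIntegral.intervalIntegral_pos_of_pos_on hI
      (fun x hx => jacobiWeight_pos a b ⟨by linarith [hx.1], by linarith [hx.2]⟩) (by norm_num),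
    fun n => ?_⟩
  have hn : (0 : ℝ) ≤ n := by positivity
  have hIn : IntervalIntegrable (jacobiWeight (a + n) (b + n)) volume (-1) 1 :=
    intervalIntegrable_jacobiWeight (by linarith) (by linarith)
  calc (3 / 4) ^ n * ∫ x in (-(1 / 2))..(1 / 2), jacobiWeight a b x
      = ∫ x in (-(1 / 2))..(1 / 2), (3 / 4) ^ n * jacobiWeight a b x :=
        (intervalIntegral.integral_const_mul _ _).symm
    _ ≤ ∫ x in (-(1 / 2))..(1 / 2), jacobiWeight (a + n) (b + n) x := by
        refine intervalIntegral.integral_mono_on (by norm_num) (hI.const_mul _)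
          (hIn.mono_set hsub) fun x hx => ?_
        have hx' : x ∈ Ioo (-1 : ℝ) 1 := ⟨by linarith [hx.1], by linarith [hx.2]⟩
        rw [jacobiWeight_add_nat a b n hx', mul_comm]
        refine mul_le_mul_of_nonneg_left (pow_le_pow_left₀ (by norm_num) ?_ n)
          (jacobiWeight_pos a b hx').le
        nlinarith [hx.1, hx.2]
    _ ≤ ∫ x in (-1)..1, jacobiWeight (a + n) (b + n) x := by
        refine intervalIntegral.integral_mono_interval (by norm_num) (by norm_num) (by norm_num)
          ?_ hIn
        filter_upwards [ae_restrict_mem measurableSet_Ioc] with x hx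
        exact jacobiWeight_nonneg _ _ (Ioc_subset_Icc_self hx)

theorem exists_sq_jacobiPhi_le {a b : ℝ} (ha : -1 < a) (hb : -1 < b) (hab : 0 < a + b + 1) :
    ∃ M K : ℝ, 0 ≤ M ∧ 0 ≤ K ∧ ∀ (n : ℕ), ∀ x ∈ Icc (-1 : ℝ) 1,
      (jacobiPhi a b n).eval x ^ 2 ≤ M * (K * ((n : ℝ) + 1) ^ 2) ^ n := by
  obtain ⟨J, hJ, hJn⟩ := exists_le_integral_jacobiWeight ha hb
  have hZ := jacobiMass_pos ha hb
  -- Below, Q carries the factor 4, and dividing by 3/4 gives 16/3 ≤ 8.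
  refine ⟨jacobiMass a b / J, 8 * (2 + (a + b + 1)), by positivity, by positivity, fun n x hx => ?_⟩
  have hn : (0 : ℝ) ≤ n := by positivity
  set Q : ℝ := 4 * ((2 + (a + b + 1)) * (n + 1) ^ 2) with hQ
  have h1 := sq_eval_mul_le_of_jacobiOp ha hb hab (natDegree_jacobiPhi_le a b n)
    (jacobiOp_jacobiPhi a b n) (Q := Q) (by rw [hQ]; nlinarith [mul_nonneg hn hab.le]) x hx
  have h2 := integral_jacobiPhi_mul ha hb hab n n
  rw [if_pos rfl, integral_jacobiMeasure ha hb, inv_mul_eq_iff_eq_mul₀ hZ.ne', mul_one] at h2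
  rw [h2] at h1
  have h3 : (jacobiPhi a b n).eval x ^ 2 * ((3 / 4) ^ n * J) ≤ Q ^ n * jacobiMass a b :=
    (mul_le_mul_of_nonneg_left (hJn n) (sq_nonneg _)).trans h1
  have h4 : (0 : ℝ) < (3 / 4) ^ n := by positivity
  rw [← mul_assoc, ← le_div_iff₀ hJ, ← le_div_iff₀ h4] at h3
  refine h3.trans ?_
  have h5 : Q ^ n * jacobiMass a b / J / (3 / 4) ^ n = jacobiMass a b / J * (Q / (3 / 4)) ^ n := by
    rw [div_pow Q]
    generalize (3 / 4 : ℝ) ^ n = c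
    ring
  rw [h5]
  have h6 : Q / (3 / 4) ≤ 8 * (2 + (a + b + 1)) * (n + 1) ^ 2 := by
    rw [hQ, div_le_iff₀ (by norm_num)]
    nlinarith [mul_nonneg (show 0 ≤ 2 + (a + b + 1) by linarith) (sq_nonneg ((n : ℝ) + 1))]
  have h7 : 0 ≤ Q / (3 / 4) := by positivity
  gcongr

-- Since the eigenvalue is at least n², each term is at most the n-th power of exp(-sn) K (n + 1)².
-- That base tends to 0, so the series is eventually dominated by a geometric one.
open Filter Topology in
theorem summable_exp_mul_pow {a b : ℝ} (hab : 0 < a + b + 1) {s : ℝ} (hs : 0 < s) {K : ℝ}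
    (hK : 0 ≤ K) :
    Summable fun n : ℕ => Real.exp (-(jacobiEig a b n * s)) * (K * ((n : ℝ) + 1) ^ 2) ^ n := by
  have hlim : Tendsto (fun n : ℕ => Real.exp (-(s * n)) * (K * ((n : ℝ) + 1) ^ 2)) atTop (𝓝 0) := by
    have h1 := (Real.tendsto_pow_mul_exp_neg_atTop_nhds_zero 2).comp
      ((tendsto_natCast_atTop_atTop (R := ℝ)).atTop_add tendsto_const_nhds |>.const_mul_atTop hs :
        Tendsto (fun n : ℕ => s * ((n : ℝ) + 1)) atTop atTop)
    have h2 := h1.const_mul (K / s ^ 2 * Real.exp s)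
    rw [mul_zero] at h2
    refine h2.congr fun n => ?_
    simp only [Function.comp]
    rw [show -(s * (n : ℝ)) = s + -(s * (n + 1)) by ring, Real.exp_add]
    field_simp
  have hev : ∀ᶠ n : ℕ in atTop,
      Real.exp (-(s * n)) * (K * ((n : ℝ) + 1) ^ 2) ≤ 1 / 2 :=
    (hlim.eventually_lt_const (by norm_num)).mono fun _ h => h.le
  refine Summable.of_norm_bounded_eventually_nat (g := fun n => (1 / 2 : ℝ) ^ n)
    (summable_geometric_of_lt_one (by norm_num) (by norm_num)) ?_
  filter_upwards [hev] with n hn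
  rw [Real.norm_of_nonneg (by positivity)]
  have h1 : Real.exp (-(jacobiEig a b n * s)) ≤ Real.exp (-(s * n)) ^ n := by
    rw [← Real.exp_nat_mul]
    refine Real.exp_le_exp.2 ?_
    rw [jacobiEig]
    have : 0 ≤ (n : ℝ) * (a + b + 1) * s := by positivity
    nlinarith
  calc Real.exp (-(jacobiEig a b n * s)) * (K * ((n : ℝ) + 1) ^ 2) ^ n
      ≤ Real.exp (-(s * n)) ^ n * (K * ((n : ℝ) + 1) ^ 2) ^ n := by gcongr
    _ = (Real.exp (-(s * n)) * (K * ((n : ℝ) + 1) ^ 2)) ^ n := (mul_pow _ _ _).symm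
    _ ≤ (1 / 2) ^ n := by gcongr

/-- Sup norm bounds for the normalized Jacobi polynomials which are summable against the
heat factors. -/
theorem exists_jacobiPhi_bound {a b : ℝ} (ha : -1 < a) (hb : -1 < b) (hab : 0 < a + b + 1) :
    ∃ B : ℕ → ℝ, (∀ n, 0 ≤ B n) ∧ (∀ n, ∀ x ∈ Icc (-1 : ℝ) 1, |(jacobiPhi a b n).eval x| ≤ B n) ∧
      ∀ s : ℝ, 0 < s → Summable fun n => Real.exp (-(jacobiEig a b n * s)) * B n ^ 2 := by
  obtain ⟨M, K, hM, hK, h⟩ := exists_sq_jacobiPhi_le ha hb hab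
  refine ⟨fun n => √(M * (K * ((n : ℝ) + 1) ^ 2) ^ n), fun n => Real.sqrt_nonneg _,
    fun n x hx => Real.abs_le_sqrt (h n x hx), fun s hs => ?_⟩
  refine ((summable_exp_mul_pow hab hs hK).mul_left M).congr fun n => ?_
  rw [Real.sq_sqrt (by positivity)]
  ring

end JacobiNormalized

/-! ### The maximum principle for the one-dimensional heat equation. -/

section MaximumPrinciple

open Polynomial Filter Topology

theorem HasDerivAt.nonpos_of_eventually_le_left {f : ℝ → ℝ} {D x : ℝ} (h : HasDerivAt f D x)
    (hf : ∀ᶠ y in 𝓝[<] x, f x ≤ f y) : D ≤ 0 := by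
  have h1 := (hasDerivWithinAt_iff_tendsto_slope' (s := Iio x) (by simp)).1
    (h.hasDerivWithinAt (s := Iio x))
  refine le_of_tendsto h1 ?_
  filter_upwards [hf, self_mem_nhdsWithin] with y hy hyx
  rw [slope_def_field]
  exact div_nonpos_of_nonneg_of_nonpos (by linarith) (by linarith [show y < x from hyx])

theorem HasDerivAt.nonneg_of_eventually_le_right {f : ℝ → ℝ} {D x : ℝ} (h : HasDerivAt f D x)
    (hf : ∀ᶠ y in 𝓝[>] x, f x ≤ f y) : 0 ≤ D := by
  have h1 := (hasDerivWithinAt_iff_tendsto_slope' (s := Ioi x) (by simp)).1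
    (h.hasDerivWithinAt (s := Ioi x))
  refine ge_of_tendsto h1 ?_
  filter_upwards [hf, self_mem_nhdsWithin] with y hy hyx
  rw [slope_def_field]
  exact div_nonneg (by linarith) (by linarith [show x < y from hyx])

/-- A negative second derivative would make the point a local maximum as well; then p is locally
constant and its second derivative vanishes there. -/
theorem Polynomial.eval_derivative_derivative_nonneg_of_isLocalMin {p : ℝ[X]} {x : ℝ}
    (h : IsLocalMin (fun y => p.eval y) x) : 0 ≤ p.derivative.derivative.eval x := by
  by_contra! hneg
  have d1 : deriv (fun y => p.eval y) = fun y => p.derivative.eval y :=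
    _root_.funext fun y => (p.hasDerivAt y).deriv
  have d2 : deriv (fun y => p.derivative.eval y) = fun y => p.derivative.derivative.eval y :=
    _root_.funext fun y => (p.derivative.hasDerivAt y).deriv
  have hmax : IsLocalMax (fun y => p.eval y) x :=
    isLocalMax_of_deriv_deriv_neg (by rw [d1, d2]; exact hneg) h.deriv_eq_zero
      p.continuous.continuousAt
  have he : (fun y => p.eval y) =ᶠ[𝓝 x] fun _ => p.eval x := by
    filter_upwards [h, hmax] with y h1 h2
    exact le_antisymm h2 h1
  have h3 := he.deriv.deriv.eq_of_nhds
  rw [d1, d2] at h3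
  simp at h3
  linarith

/-- At a minimum over `[-1, 1]`, the Jacobi operator is nonnegative. -/
theorem jacobiOp_nonneg_of_isMinOn {a b : ℝ} (ha : -1 < a) (hb : -1 < b) {p : ℝ[X]} {x : ℝ}
    (hx : x ∈ Icc (-1 : ℝ) 1) (h : ∀ y ∈ Icc (-1 : ℝ) 1, p.eval x ≤ p.eval y) :
    0 ≤ (jacobiOp a b p).eval x := by
  rw [eval_jacobiOp, jacobiDiff]
  -- At an endpoint the second-order term vanishes and the drift points inwards: its coefficient is
  -- 2(b + 1) at -1 and -2(a + 1) at 1.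
  rcases hx.1.eq_or_lt with rfl | h1
  · have h2 : 0 ≤ p.derivative.eval (-1) := by
      refine (p.hasDerivAt (-1)).nonneg_of_eventually_le_right ?_
      filter_upwards [Ioo_mem_nhdsGT (show (-1 : ℝ) < 1 by norm_num)] with y hy
      exact h y (Ioo_subset_Icc_self hy)
    nlinarith
  rcases hx.2.eq_or_lt with rfl | h2
  · have h2 : p.derivative.eval 1 ≤ 0 := by
      refine (p.hasDerivAt 1).nonpos_of_eventually_le_left ?_
      filter_upwards [Ioo_mem_nhdsLT (show (-1 : ℝ) < 1 by norm_num)] with y hy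
      exact h y (Ioo_subset_Icc_self hy)
    nlinarith
  have hmin : IsLocalMin (fun y => p.eval y) x := by
    filter_upwards [Icc_mem_nhds h1 h2] with y hy
    exact h y hy
  rw [hmin.hasDerivAt_eq_zero (p.hasDerivAt x), mul_zero, add_zero]
  exact mul_nonneg (by nlinarith) (eval_derivative_derivative_nonneg_of_isLocalMin hmin)

/-- The weak maximum principle for the Jacobi heat equation with polynomial data. -/
theorem jacobi_heat_nonneg {a b : ℝ} (ha : -1 < a) (hb : -1 < b) (S : Finset ℕ) (c : ℕ → ℝ)
    (h0 : ∀ x ∈ Icc (-1 : ℝ) 1, 0 ≤ ∑ n ∈ S, c n * (jacobiPhi a b n).eval x) {t x : ℝ}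
    (ht : 0 ≤ t) (hx : x ∈ Icc (-1 : ℝ) 1) :
    0 ≤ ∑ n ∈ S, Real.exp (-(jacobiEig a b n * t)) * (c n * (jacobiPhi a b n).eval x) := by
  by_contra! hneg
  set u : ℝ → ℝ → ℝ := fun t x =>
    ∑ n ∈ S, Real.exp (-(jacobiEig a b n * t)) * (c n * (jacobiPhi a b n).eval x) with hu
  have hneg : u t x < 0 := hneg
  -- The perturbation ε(1 + t) makes the time inequality strict; this ε leaves exactly half of the
  -- negative value at (t, x).
  set ε : ℝ := -u t x / (2 * (1 + t)) with hε
  have hε0 : 0 < ε := div_pos (by linarith) (by linarith)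
  have hεt : u t x + ε * (1 + t) < 0 := by
    have : ε * (1 + t) = -u t x / 2 := by
      rw [hε]; field_simp
    rw [this]; linarith
  have hcont : Continuous fun z : ℝ × ℝ => u z.1 z.2 + ε * (1 + z.1) := by
    have : ∀ n, Continuous fun z : ℝ × ℝ => (jacobiPhi a b n).eval z.2 :=
      fun n => (jacobiPhi a b n).continuous.comp continuous_snd
    simp only [hu]
    fun_prop
  obtain ⟨⟨t1, x1⟩, ⟨ht1, hx1⟩, hmin⟩ := (isCompact_Icc.prod isCompact_Icc).exists_isMinOn
    ⟨(t, x), ⟨⟨ht, le_refl t⟩, hx⟩⟩ (f := fun z : ℝ × ℝ => u z.1 z.2 + ε * (1 + z.1))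
    hcont.continuousOn
  have hmin : ∀ t' ∈ Icc 0 t, ∀ x' ∈ Icc (-1 : ℝ) 1,
      u t1 x1 + ε * (1 + t1) ≤ u t' x' + ε * (1 + t') := fun t' ht' x' hx' =>
    hmin (show (t', x') ∈ Icc 0 t ×ˢ Icc (-1 : ℝ) 1 from ⟨ht', hx'⟩)
  simp only at ht1 hx1
  have hlt : u t1 x1 + ε * (1 + t1) < 0 := (hmin t ⟨ht, le_refl t⟩ x hx).trans_lt hεt
  have ht1pos : 0 < t1 := by
    refine lt_of_le_of_ne ht1.1 fun e => ?_
    have := h0 x1 hx1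
    rw [← e] at hlt
    simp only [hu, mul_zero, neg_zero, Real.exp_zero, one_mul] at hlt
    linarith
  have hdt : HasDerivAt (fun τ => u τ x1 + ε * (1 + τ))
      ((∑ n ∈ S, Real.exp (-(jacobiEig a b n * t1)) * -jacobiEig a b n *
        (c n * (jacobiPhi a b n).eval x1)) + ε) t1 := by
    have h1 : HasDerivAt (fun τ => ε * (1 + τ)) ε t1 := by
      simpa using ((hasDerivAt_id t1).const_add 1).const_mul ε
    refine HasDerivAt.add ?_ h1
    refine HasDerivAt.fun_sum fun n _ => ?_
    have h2 : HasDerivAt (fun τ : ℝ => -(jacobiEig a b n * τ)) (-jacobiEig a b n) t1 := by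
      simpa using ((hasDerivAt_id t1).const_mul (jacobiEig a b n)).fun_neg
    exact h2.exp.mul_const _
  -- Only earlier times are compared, since t1 may be the final time t.
  have hD := hdt.nonpos_of_eventually_le_left (by
    filter_upwards [Ioo_mem_nhdsLT ht1pos] with τ hτ
    exact hmin τ ⟨hτ.1.le, hτ.2.le.trans ht1.2⟩ x1 hx1)
  set P : ℝ[X] := ∑ n ∈ S, C (Real.exp (-(jacobiEig a b n * t1)) * c n) * jacobiPhi a b n with hP
  have hPu : ∀ y, P.eval y = u t1 y := by
    intro y
    simp [hP, hu, eval_finsetSum, mul_assoc]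
  -- At the minimum the spatial operator is nonnegative. It equals the time derivative of u, which
  -- `hD` bounds by -ε: a contradiction.
  have hL := jacobiOp_nonneg_of_isMinOn ha hb (p := P) hx1 (by
    intro y hy
    rw [hPu, hPu]
    linarith [hmin t1 ht1 y hy])
  rw [hP, jacobiOp_sum] at hL
  simp only [jacobiOp_jacobiPhi, eval_finsetSum, eval_mul, eval_neg, eval_C] at hL
  have e : ∑ n ∈ S, Real.exp (-(jacobiEig a b n * t1)) * -jacobiEig a b n *
        (c n * (jacobiPhi a b n).eval x1) = ∑ n ∈ S, Real.exp (-(jacobiEig a b n * t1)) * c n *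
        (-jacobiEig a b n * (jacobiPhi a b n).eval x1) :=
    Finset.sum_congr rfl fun n _ => by ring
  rw [e] at hD
  linarith

end MaximumPrinciple

/-! ### Termwise integration of eigenfunction series. -/

/-- Integration against a series which converges uniformly on a set of full measure. -/
theorem hasSum_integral_mul_tsum {X ι : Type*} [Countable ι] [MeasurableSpace X] {μ : Measure X}
    [IsFiniteMeasure μ] {g : X → ℝ} (hg : AEStronglyMeasurable g μ) {G : ℝ}
    (hG : ∀ᵐ y ∂μ, |g y| ≤ G) {ψ : ι → X → ℝ} (hψ : ∀ k, AEStronglyMeasurable (ψ k) μ)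
    {M : ι → ℝ} (hM : ∀ k, ∀ᵐ y ∂μ, |ψ k y| ≤ M k) {w : ι → ℝ}
    (hw : Summable fun k => |w k| * M k) :
    HasSum (fun k => w k * ∫ y, g y * ψ k y ∂μ) (∫ y, g y * ∑' k, w k * ψ k y ∂μ) := by
  rcases eq_or_ne μ 0 with rfl | hμ
  · simp
  have : (ae μ).NeBot := ae_neBot.2 hμ
  have hM0 : ∀ k, 0 ≤ M k := fun k => by
    obtain ⟨y, hy⟩ := (hM k).exists
    exact (abs_nonneg _).trans hy
  have hG0 : 0 ≤ G := by
    obtain ⟨y, hy⟩ := hG.exists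
    exact (abs_nonneg _).trans hy
  have hb : ∀ k, ∀ᵐ y ∂μ, ‖g y * (w k * ψ k y)‖ ≤ G * (|w k| * M k) := by
    intro k
    filter_upwards [hG, hM k] with y h1 h2
    rw [norm_mul, norm_mul, Real.norm_eq_abs, Real.norm_eq_abs, Real.norm_eq_abs]
    gcongr
  have hi : ∀ k, Integrable (fun y => g y * (w k * ψ k y)) μ := fun k =>
    Integrable.of_bound (hg.mul ((hψ k).const_mul _)) _ (hb k)
  have hs : Summable fun k => ∫ y, ‖g y * (w k * ψ k y)‖ ∂μ := by
    refine Summable.of_nonneg_of_le (fun k => integral_nonneg fun y => norm_nonneg _) (fun k => ?_)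
      ((hw.mul_left G).mul_left (μ.real univ))
    have := integral_mono_ae (hi k).norm (integrable_const (G * (|w k| * M k))) (hb k)
    simpa using this
  have h := hasSum_integral_of_summable_integral_norm hi hs
  simp only [tsum_mul_left] at h
  refine h.congr_fun ?_ |> fun h => h
  intro k
  rw [← integral_const_mul]
  congr 1
  ext y
  ring

/-! ### The one-dimensional heat kernel: nonnegativity and unit mass. -/

section OneDimensionalKernel

open Polynomial

/-- The one-dimensional Jacobi heat kernel. -/
noncomputable def jacobiKernelOne (a b t x y : ℝ) : ℝ :=
  ∑' n : ℕ, Real.exp (-(jacobiEig a b n * t)) * (jacobiPhi a b n).eval x * (jacobiPhi a b n).eval y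

variable {a b : ℝ}

theorem summable_jacobiPhi_bound {B : ℕ → ℝ} (hB0 : ∀ n, 0 ≤ B n)
    (hB : ∀ n, ∀ x ∈ Icc (-1 : ℝ) 1, |(jacobiPhi a b n).eval x| ≤ B n)
    {t : ℝ} (hs : Summable fun n => Real.exp (-(jacobiEig a b n * t)) * B n ^ 2)
    {x : ℝ} (hx : x ∈ Icc (-1 : ℝ) 1) :
    Summable fun n => |Real.exp (-(jacobiEig a b n * t)) * (jacobiPhi a b n).eval x| * B n := by
  refine Summable.of_nonneg_of_le (fun n => mul_nonneg (abs_nonneg _) (hB0 n)) (fun n => ?_) hs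
  rw [abs_mul, abs_of_pos (Real.exp_pos _), mul_assoc, sq]
  gcongr
  · exact hB0 n
  · exact hB n x hx

theorem continuousOn_jacobiKernelOne (ha : -1 < a) (hb : -1 < b) (hab : 0 < a + b + 1) {t x : ℝ}
    (ht : 0 < t) (hx : x ∈ Icc (-1 : ℝ) 1) :
    ContinuousOn (jacobiKernelOne a b t x) (Icc (-1) 1) := by
  obtain ⟨B, hB0, hB, hs⟩ := exists_jacobiPhi_bound ha hb hab
  refine continuousOn_tsum (fun n => ?_) (summable_jacobiPhi_bound hB0 hB (hs t ht) hx)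
    fun n y hy => ?_
  · exact (continuous_const.mul (jacobiPhi a b n).continuous).continuousOn
  · rw [norm_mul, Real.norm_eq_abs, Real.norm_eq_abs]
    gcongr
    exact hB n y hy

theorem hasSum_integral_mul_jacobiKernelOne (ha : -1 < a) (hb : -1 < b) (hab : 0 < a + b + 1)
    {t x : ℝ} (ht : 0 < t) (hx : x ∈ Icc (-1 : ℝ) 1) (q : ℝ[X]) :
    HasSum (fun n => Real.exp (-(jacobiEig a b n * t)) * (jacobiPhi a b n).eval x *
        ∫ y, q.eval y * (jacobiPhi a b n).eval y ∂(jacobiMeasure a b))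
      (∫ y, q.eval y * jacobiKernelOne a b t x y ∂(jacobiMeasure a b)) := by
  have := isFiniteMeasure_jacobiMeasure ha hb
  obtain ⟨B, hB0, hB, hs⟩ := exists_jacobiPhi_bound ha hb hab
  obtain ⟨G, hG⟩ := isCompact_Icc.exists_bound_of_continuousOn
    (q.continuous.continuousOn (s := Icc (-1 : ℝ) 1))
  exact hasSum_integral_mul_tsum q.continuous.aestronglyMeasurable
    ((ae_mem_jacobiMeasure a b).mono fun y hy => hG y hy)
    (fun n => (jacobiPhi a b n).continuous.aestronglyMeasurable)
    (fun n => (ae_mem_jacobiMeasure a b).mono fun y hy => hB n y hy)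
    (summable_jacobiPhi_bound hB0 hB (hs t ht) hx)

/-- By orthonormality only the terms indexed by S survive, so on polynomials the kernel produces
exactly the finite sums covered by the maximum principle. -/
theorem integral_mul_jacobiKernelOne_sum (ha : -1 < a) (hb : -1 < b) (hab : 0 < a + b + 1)
    {t x : ℝ} (ht : 0 < t) (hx : x ∈ Icc (-1 : ℝ) 1) (S : Finset ℕ) (c : ℕ → ℝ) :
    ∫ y, (∑ n ∈ S, C (c n) * jacobiPhi a b n).eval y * jacobiKernelOne a b t x y
      ∂(jacobiMeasure a b) =
    ∑ n ∈ S, Real.exp (-(jacobiEig a b n * t)) * (c n * (jacobiPhi a b n).eval x) := by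
  have hcoef : ∀ m, ∫ y, (∑ n ∈ S, C (c n) * jacobiPhi a b n).eval y * (jacobiPhi a b m).eval y
      ∂(jacobiMeasure a b) = if m ∈ S then c m else 0 := by
    intro m
    simp only [eval_finsetSum, eval_mul, eval_C, Finset.sum_mul, mul_assoc]
    have hi : ∀ n, Integrable (fun y => (jacobiPhi a b n).eval y * (jacobiPhi a b m).eval y)
        (jacobiMeasure a b) := fun n => integrable_jacobiMeasure ha hb
      ((jacobiPhi a b n).continuous.mul (jacobiPhi a b m).continuous).continuousOn
    rw [integral_finsetSum _ fun n _ => (hi n).const_mul _]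
    simp [integral_const_mul, integral_jacobiPhi_mul ha hb hab]
  rw [← (hasSum_integral_mul_jacobiKernelOne ha hb hab ht hx _).tsum_eq]
  simp only [hcoef]
  rw [tsum_eq_sum (s := S) fun n hn => by simp [hn]]
  refine Finset.sum_congr rfl fun n hn => ?_
  rw [if_pos hn]
  ring

theorem exists_eq_sum_jacobiPhi (ha : -1 < a) (hb : -1 < b) (hab : 0 < a + b + 1) (q : ℝ[X]) :
    ∃ (S : Finset ℕ) (c : ℕ → ℝ), q = ∑ n ∈ S, C (c n) * jacobiPhi a b n := by
  have h : q ∈ Submodule.span ℝ (Set.range (jacobiPhi a b)) := by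
    rw [span_jacobiPhi ha hb hab]
    exact Submodule.mem_top
  obtain ⟨c, hc⟩ := Finsupp.mem_span_range_iff_exists_finsupp.1 h
  refine ⟨c.support, c, ?_⟩
  rw [← hc, Finsupp.sum]
  simp only [smul_eq_C_mul]

theorem integral_mul_jacobiKernelOne_nonneg (ha : -1 < a) (hb : -1 < b) (hab : 0 < a + b + 1)
    {t x : ℝ} (ht : 0 < t) (hx : x ∈ Icc (-1 : ℝ) 1) {q : ℝ[X]}
    (hq : ∀ y ∈ Icc (-1 : ℝ) 1, 0 ≤ q.eval y) :
    0 ≤ ∫ y, q.eval y * jacobiKernelOne a b t x y ∂(jacobiMeasure a b) := by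
  obtain ⟨S, c, rfl⟩ := exists_eq_sum_jacobiPhi ha hb hab q
  rw [integral_mul_jacobiKernelOne_sum ha hb hab ht hx]
  refine jacobi_heat_nonneg ha hb S c (fun y hy => ?_) ht.le hx
  simpa [eval_finsetSum] using hq y hy

theorem integral_jacobiKernelOne (ha : -1 < a) (hb : -1 < b) (hab : 0 < a + b + 1)
    {t x : ℝ} (ht : 0 < t) (hx : x ∈ Icc (-1 : ℝ) 1) :
    ∫ y, jacobiKernelOne a b t x y ∂(jacobiMeasure a b) = 1 := by
  obtain ⟨v, hv⟩ : ∃ v, jacobiPhi a b 0 = C v :=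
    ⟨_, eq_C_of_natDegree_le_zero (natDegree_jacobiPhi_le a b 0)⟩
  have hv0 : v ≠ 0 := by
    rintro rfl
    have := integral_jacobiPhi_mul ha hb hab 0 0
    simp [hv] at this
  -- This combination is the constant 1, whose eigenvalue is 0.
  have h := integral_mul_jacobiKernelOne_sum ha hb hab ht hx {0} fun _ => v⁻¹
  simpa [hv, ← C_mul, hv0, jacobiEig] using h

/-- Test the kernel k against its own negative part g. Nonnegative polynomials approximate g
uniformly, so the integral of g k is nonnegative; but g k = -g², hence g vanishes almost everywhere.
-/
theorem jacobiKernelOne_nonneg_ae (ha : -1 < a) (hb : -1 < b) (hab : 0 < a + b + 1)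
    {t x : ℝ} (ht : 0 < t) (hx : x ∈ Icc (-1 : ℝ) 1) :
    ∀ᵐ y ∂(jacobiMeasure a b), 0 ≤ jacobiKernelOne a b t x y := by
  have hfin := isFiniteMeasure_jacobiMeasure ha hb
  set k := jacobiKernelOne a b t x with hk
  have hkc : ContinuousOn k (Icc (-1) 1) := continuousOn_jacobiKernelOne ha hb hab ht hx
  set g : ℝ → ℝ := fun y => max (-k y) 0 with hg
  have hgc : ContinuousOn g (Icc (-1) 1) := hkc.neg.sup continuousOn_const
  have hgk : ∀ y, g y * k y = -g y ^ 2 := by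
    intro y
    simp only [hg]
    rcases le_total 0 (k y) with h | h
    · rw [max_eq_right (by linarith)]; ring
    · rw [max_eq_left (by linarith)]; ring
  have hkabs := integrable_jacobiMeasure ha hb hkc.abs
  have hgki : Integrable (fun y => g y * k y) (jacobiMeasure a b) :=
    integrable_jacobiMeasure ha hb (hgc.mul hkc)
  have hlow : ∀ ε > 0, -(2 * ε * ∫ y, |k y| ∂(jacobiMeasure a b)) ≤
      ∫ y, g y * k y ∂(jacobiMeasure a b) := by
    intro ε hε
    obtain ⟨q, hq⟩ := exists_polynomial_near_of_continuousOn (-1) 1 g hgc ε hε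
    -- Adding ε makes the approximant nonnegative on the interval and at most doubles the error.
    have h1 := integral_mul_jacobiKernelOne_nonneg ha hb hab ht hx (q := q + C ε) (by
      intro y hy
      have h2 := (abs_lt.1 (hq y hy)).1
      have h3 : 0 ≤ g y := le_max_right _ _
      simp only [eval_add, eval_C]
      linarith)
    have h4 : ∫ y, (q + C ε).eval y * k y ∂(jacobiMeasure a b) ≤
        ∫ y, g y * k y + 2 * ε * |k y| ∂(jacobiMeasure a b) := by
      refine integral_mono_ae (integrable_jacobiMeasure ha hb
        ((q + C ε).continuous.continuousOn.mul hkc)) (hgki.add (hkabs.const_mul _)) ?_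
      filter_upwards [ae_mem_jacobiMeasure a b] with y hy
      have h5 := abs_lt.1 (hq y hy)
      have h6 : |q.eval y + ε - g y| ≤ 2 * ε := abs_le.2 ⟨by linarith, by linarith⟩
      have h7 : (q.eval y + ε - g y) * k y ≤ 2 * ε * |k y| := by
        refine (le_abs_self _).trans ?_
        rw [abs_mul]
        gcongr
      simp only [eval_add, eval_C]
      linarith
    rw [integral_add hgki (hkabs.const_mul _), integral_const_mul] at h4
    linarith
  have hnn : 0 ≤ ∫ y, g y * k y ∂(jacobiMeasure a b) := by
    by_contra! hneg
    set I := ∫ y, |k y| ∂(jacobiMeasure a b)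
    have hI : 0 ≤ I := integral_nonneg fun y => abs_nonneg _
    set m := ∫ y, g y * k y ∂(jacobiMeasure a b)
    -- With this ε the error 2εI is at most -m/2; the 1 in I + 1 guards against I = 0.
    have h1 := hlow (-m / (4 * (I + 1))) (div_pos (by linarith) (by linarith))
    have h2 : 2 * (-m / (4 * (I + 1))) * I = -m / 2 * (I / (I + 1)) := by
      field_simp
      ring
    have h3 : I / (I + 1) ≤ 1 := (div_le_one (by linarith)).2 (by linarith)
    rw [h2] at h1
    nlinarith
  simp only [hgk, integral_neg] at hnn
  have hg2 := integrable_jacobiMeasure ha hb (hgc.pow 2)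
  have h0 : ∫ y, g y ^ 2 ∂(jacobiMeasure a b) = 0 :=
    le_antisymm (by linarith) (integral_nonneg fun y => sq_nonneg _)
  filter_upwards [(integral_eq_zero_iff_of_nonneg (fun y => sq_nonneg (g y)) hg2).1 h0] with y hy
  have h1 : g y = 0 := by simpa using hy
  have h2 : -k y ≤ g y := le_max_left _ _
  linarith

theorem integral_abs_jacobiKernelOne (ha : -1 < a) (hb : -1 < b) (hab : 0 < a + b + 1)
    {t x : ℝ} (ht : 0 < t) (hx : x ∈ Icc (-1 : ℝ) 1) :
    ∫ y, |jacobiKernelOne a b t x y| ∂(jacobiMeasure a b) = 1 := by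
  rw [← integral_jacobiKernelOne ha hb hab ht hx]
  refine integral_congr_ae ?_
  filter_upwards [jacobiKernelOne_nonneg_ae ha hb hab ht hx] with y hy
  exact abs_of_nonneg hy

end OneDimensionalKernel

/-! ### Factorization of series over multi-indices. -/

section ProductSeries

/-- Induction on d, splitting off the first index. The claims are proved together because
multiplying the two sums requires the absolute convergence from the inductive hypothesis. -/
theorem summable_norm_prod_and_tsum_prod {d : ℕ} (f : Fin d → ℕ → ℝ)
    (hf : ∀ i, Summable fun n => ‖f i n‖) :
    (Summable fun κ : Fin d → ℕ => ‖∏ i, f i (κ i)‖) ∧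
      ∑' κ : Fin d → ℕ, ∏ i, f i (κ i) = ∏ i, ∑' n, f i n := by
  induction d with
  | zero => exact ⟨(hasSum_fintype _).summable, by simp⟩
  | succ d ih =>
    obtain ⟨h1, h2⟩ := ih (fun i => f i.succ) fun i => hf i.succ
    obtain ⟨q, hq⟩ : ∃ q : (Fin d → ℕ) → ℝ, ∀ κ, q κ = ∏ i, f i.succ (κ i) := ⟨_, fun _ => rfl⟩
    simp only [← hq] at h1 h2
    have hs : Summable fun z : ℕ × (Fin d → ℕ) => ‖f 0 z.1 * q z.2‖ := (hf 0).mul_norm h1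
    have e : ∀ z : ℕ × (Fin d → ℕ), ∏ i, f i (Fin.consEquiv (fun _ => ℕ) z i) =
        f 0 z.1 * q z.2 := by
      intro z
      rw [Fin.prod_univ_succ, hq]
      simp [Fin.consEquiv]
    constructor
    · rw [← (Fin.consEquiv fun _ => ℕ).summable_iff]
      refine hs.congr fun z => ?_
      simp only [Function.comp, e]
    · rw [← (Fin.consEquiv fun _ => ℕ).tsum_eq]
      simp only [e]
      rw [← tsum_mul_tsum_of_summable_norm (hf 0) h1, h2, Fin.prod_univ_succ]

end ProductSeries

/-! ### The semigroup on the cube: contraction, decay, time derivative. -/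

section MultiDimensional

variable {d : ℕ} {α β : Fin d → ℝ}

theorem isFiniteMeasure_jacobiMeasurePi (hα : ∀ i, -1 < α i) (hβ : ∀ i, -1 < β i) :
    IsFiniteMeasure (jacobiMeasurePi α β) := by
  have := fun i => isFiniteMeasure_jacobiMeasure (hα i) (hβ i)
  unfold jacobiMeasurePi
  infer_instance

theorem ae_mem_jacobiMeasurePi (hα : ∀ i, -1 < α i) (hβ : ∀ i, -1 < β i) :
    ∀ᵐ y ∂(jacobiMeasurePi α β), y ∈ Icc (fun _ : Fin d => (-1 : ℝ)) fun _ => 1 := by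
  have := fun i => isFiniteMeasure_jacobiMeasure (hα i) (hβ i)
  have h : ∀ i, ∀ᵐ y ∂(jacobiMeasurePi α β), y i ∈ Icc (-1 : ℝ) 1 := fun i =>
    (Measure.tendsto_eval_ae_ae (μ := fun i => jacobiMeasure (α i) (β i))).eventually
      (ae_mem_jacobiMeasure (α i) (β i))
  filter_upwards [ae_all_iff.2 h] with y hy
  exact ⟨fun i => (hy i).1, fun i => (hy i).2⟩

theorem aestronglyMeasurable_jacobiMeasurePi (hα : ∀ i, -1 < α i) (hβ : ∀ i, -1 < β i)
    {g : (Fin d → ℝ) → ℝ} (hg : ContinuousOn g (Icc (fun _ => -1) fun _ => 1)) :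
    AEStronglyMeasurable g (jacobiMeasurePi α β) := by
  rw [← Measure.restrict_eq_self_of_ae_mem (ae_mem_jacobiMeasurePi hα hβ)]
  exact hg.aestronglyMeasurable measurableSet_Icc

theorem integrable_jacobiMeasurePi (hα : ∀ i, -1 < α i) (hβ : ∀ i, -1 < β i)
    {g : (Fin d → ℝ) → ℝ} (hg : ContinuousOn g (Icc (fun _ => -1) fun _ => 1)) :
    Integrable g (jacobiMeasurePi α β) := by
  have := isFiniteMeasure_jacobiMeasurePi hα hβ
  obtain ⟨G, hG⟩ := isCompact_Icc.exists_bound_of_continuousOn hg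
  exact Integrable.of_bound (aestronglyMeasurable_jacobiMeasurePi hα hβ hg) G
    ((ae_mem_jacobiMeasurePi hα hβ).mono hG)

theorem jacobiPoly_eq (κ : Fin d → ℕ) (x : Fin d → ℝ) :
    jacobiPoly α β κ x = ∏ i, (jacobiPhi (α i) (β i) (κ i)).eval (x i) := by
  simp only [jacobiPoly, jacobiPhi_eval]

theorem continuous_jacobiPoly (κ : Fin d → ℕ) : Continuous (jacobiPoly α β κ) := by
  have : jacobiPoly α β κ = fun x => ∏ i, (jacobiPhi (α i) (β i) (κ i)).eval (x i) :=
    funext fun x => jacobiPoly_eq κ x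
  rw [this]
  exact continuous_finsetProd _ fun i _ => (jacobiPhi _ _ _).continuous.comp (continuous_apply i)

theorem exp_jacobiEigenvalue (κ : Fin d → ℕ) (t : ℝ) :
    Real.exp (-jacobiEigenvalue α β κ * t) =
      ∏ i, Real.exp (-(jacobiEig (α i) (β i) (κ i) * t)) := by
  rw [← Real.exp_sum]
  congr 1
  rw [jacobiEigenvalue, Finset.sum_neg_distrib, neg_mul, Finset.sum_mul]
  rfl

theorem exists_jacobiPoly_bound (hα : ∀ i, -1 < α i) (hβ : ∀ i, -1 < β i)
    (hαβ : ∀ i, 0 < α i + β i + 1) :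
    ∃ M : (Fin d → ℕ) → ℝ, (∀ κ, 0 ≤ M κ) ∧
      (∀ κ, ∀ x ∈ Icc (fun _ => -1) (fun _ => 1), |jacobiPoly α β κ x| ≤ M κ) ∧
      ∀ t : ℝ, 0 < t → Summable fun κ => Real.exp (-jacobiEigenvalue α β κ * t) * M κ ^ 2 := by
  choose B hB0 hB hs using fun i => exists_jacobiPhi_bound (hα i) (hβ i) (hαβ i)
  refine ⟨fun κ => ∏ i, B i (κ i), fun κ => Finset.prod_nonneg fun i _ => hB0 i _,
    fun κ x hx => ?_, fun t ht => ?_⟩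
  · rw [jacobiPoly_eq, Finset.abs_prod]
    exact Finset.prod_le_prod (fun i _ => abs_nonneg _) fun i _ => hB i _ _ ⟨hx.1 i, hx.2 i⟩
  · refine (summable_norm_prod_and_tsum_prod
      (fun i n => Real.exp (-(jacobiEig (α i) (β i) n * t)) * B i n ^ 2)
      fun i => (hs i t ht).norm).1.of_norm.congr fun κ => ?_
    rw [exp_jacobiEigenvalue, Finset.prod_mul_distrib, Finset.prod_pow]

/-- Eigenvalues add and polynomials multiply over coordinates. This carries the L¹ norm of the
kernel from dimension one to dimension d. -/
theorem jacobiKernel_eq_prod (hα : ∀ i, -1 < α i) (hβ : ∀ i, -1 < β i)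
    (hαβ : ∀ i, 0 < α i + β i + 1) {t : ℝ} (ht : 0 < t) {x y : Fin d → ℝ}
    (hx : x ∈ Icc (fun _ => -1) (fun _ => 1)) (hy : y ∈ Icc (fun _ => -1) (fun _ => 1)) :
    jacobiKernel α β t x y = ∏ i, jacobiKernelOne (α i) (β i) t (x i) (y i) := by
  simp only [jacobiKernelOne]
  rw [← (summable_norm_prod_and_tsum_prod _ ?_).2, jacobiKernel]
  · congr 1
    ext κ
    rw [exp_jacobiEigenvalue, jacobiPoly_eq, jacobiPoly_eq, Finset.prod_mul_distrib,
      Finset.prod_mul_distrib]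
  · intro i
    obtain ⟨B, hB0, hB, hs⟩ := exists_jacobiPhi_bound (hα i) (hβ i) (hαβ i)
    refine Summable.of_nonneg_of_le (fun n => norm_nonneg _) (fun n => ?_)
      (summable_jacobiPhi_bound hB0 hB (hs t ht) ⟨hx.1 i, hx.2 i⟩)
    rw [norm_mul, Real.norm_eq_abs, Real.norm_eq_abs]
    gcongr
    exact hB n _ ⟨hy.1 i, hy.2 i⟩

/-- The Jacobi semigroup is a contraction for the sup norm. -/
theorem abs_jacobiSemigroup_le (hα : ∀ i, -1 < α i) (hβ : ∀ i, -1 < β i)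
    (hαβ : ∀ i, 0 < α i + β i + 1) {g : (Fin d → ℝ) → ℝ} {G : ℝ}
    (hG : ∀ y ∈ Icc (fun _ => -1) (fun _ => 1), |g y| ≤ G) {t : ℝ} (ht : 0 < t) {x : Fin d → ℝ}
    (hx : x ∈ Icc (fun _ => -1) (fun _ => 1)) : |jacobiSemigroup α β t g x| ≤ G := by
  have := fun i => isFiniteMeasure_jacobiMeasure (hα i) (hβ i)
  have hxi : ∀ i, x i ∈ Icc (-1 : ℝ) 1 := fun i => ⟨hx.1 i, hx.2 i⟩
  rw [jacobiSemigroup, if_neg ht.ne', ← Real.norm_eq_abs]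
  have hi : Integrable (fun y : Fin d → ℝ => ∏ i, |jacobiKernelOne (α i) (β i) t (x i) (y i)|)
      (jacobiMeasurePi α β) :=
    Integrable.fintype_prod (f := fun i y => |jacobiKernelOne (α i) (β i) t (x i) y|) fun i =>
      integrable_jacobiMeasure (hα i) (hβ i)
        (continuousOn_jacobiKernelOne (hα i) (hβ i) (hαβ i) ht (hxi i)).abs
  refine (norm_integral_le_of_norm_le (hi.const_mul G) ?_).trans ?_
  · filter_upwards [ae_mem_jacobiMeasurePi hα hβ] with y hy
    rw [jacobiKernel_eq_prod hα hβ hαβ ht hx hy, norm_mul, Real.norm_eq_abs, Real.norm_eq_abs,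
      Finset.abs_prod]
    exact mul_le_mul_of_nonneg_right (hG y hy) (Finset.prod_nonneg fun i _ => abs_nonneg _)
  · rw [integral_const_mul, jacobiMeasurePi,
      integral_fintype_prod_eq_prod (fun i y => |jacobiKernelOne (α i) (β i) t (x i) y|)]
    simp only [fun i => integral_abs_jacobiKernelOne (hα i) (hβ i) (hαβ i) ht (hxi i),
      Finset.prod_const_one, mul_one, le_refl]

theorem hasSum_jacobiSemigroup (hα : ∀ i, -1 < α i) (hβ : ∀ i, -1 < β i)
    (hαβ : ∀ i, 0 < α i + β i + 1) {g : (Fin d → ℝ) → ℝ}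
    (hg : ContinuousOn g (Icc (fun _ => -1) fun _ => 1)) {t : ℝ} (ht : 0 < t) {x : Fin d → ℝ}
    (hx : x ∈ Icc (fun _ => -1) (fun _ => 1)) :
    HasSum (fun κ => Real.exp (-jacobiEigenvalue α β κ * t) * jacobiPoly α β κ x *
      ∫ y, g y * jacobiPoly α β κ y ∂(jacobiMeasurePi α β)) (jacobiSemigroup α β t g x) := by
  have := isFiniteMeasure_jacobiMeasurePi hα hβ
  obtain ⟨M, hM0, hM, hs⟩ := exists_jacobiPoly_bound hα hβ hαβ
  obtain ⟨G, hG⟩ := isCompact_Icc.exists_bound_of_continuousOn hg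
  rw [jacobiSemigroup, if_neg ht.ne']
  refine hasSum_integral_mul_tsum (aestronglyMeasurable_jacobiMeasurePi hα hβ hg)
    ((ae_mem_jacobiMeasurePi hα hβ).mono hG)
    (fun κ => (continuous_jacobiPoly κ).aestronglyMeasurable)
    (fun κ => (ae_mem_jacobiMeasurePi hα hβ).mono (hM κ)) ?_
  refine Summable.of_nonneg_of_le (fun κ => mul_nonneg (abs_nonneg _) (hM0 κ)) (fun κ => ?_)
    (hs t ht)
  rw [abs_mul, abs_of_pos (Real.exp_pos _), mul_assoc, sq]
  gcongr
  · exact hM0 κ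
  · exact hM κ x hx

theorem abs_integral_mul_jacobiPoly_le (hα : ∀ i, -1 < α i) (hβ : ∀ i, -1 < β i)
    {g : (Fin d → ℝ) → ℝ} {G : ℝ} (hG0 : 0 ≤ G)
    (hG : ∀ y ∈ Icc (fun _ => -1) (fun _ => 1), |g y| ≤ G) {κ : Fin d → ℕ} {M : ℝ}
    (hM : ∀ x ∈ Icc (fun _ => -1) (fun _ => 1), |jacobiPoly α β κ x| ≤ M) :
    |∫ y, g y * jacobiPoly α β κ y ∂(jacobiMeasurePi α β)| ≤
      G * M * (jacobiMeasurePi α β).real univ := by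
  have := isFiniteMeasure_jacobiMeasurePi hα hβ
  rw [← Real.norm_eq_abs]
  refine norm_integral_le_of_norm_le_const ?_
  filter_upwards [ae_mem_jacobiMeasurePi hα hβ] with y hy
  rw [norm_mul, Real.norm_eq_abs, Real.norm_eq_abs]
  exact mul_le_mul (hG y hy) (hM y hy) (abs_nonneg _) hG0

theorem jacobiGap_pos (hd : 0 < d) (hαβ : ∀ i, 0 < α i + β i + 1) : 0 < jacobiGap α β := by
  have : Nonempty (Fin d) := ⟨⟨0, hd⟩⟩
  obtain ⟨i, hi⟩ := exists_eq_ciInf_of_finite (f := fun j => α j + β j + 2)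
  rw [jacobiGap, ← hi]
  linarith [hαβ i]

/-- Some κ_i is at least 1, and its summand is then at least α_i + β_i + 2; the other summands are
nonnegative. -/
theorem jacobiGap_le_jacobiEigenvalue (hαβ : ∀ i, 0 < α i + β i + 1) {κ : Fin d → ℕ}
    (hκ : κ ≠ 0) : jacobiGap α β ≤ jacobiEigenvalue α β κ := by
  obtain ⟨i, hi⟩ := Function.ne_iff.1 hκ
  have h1 : (1 : ℝ) ≤ κ i := by exact_mod_cast Nat.one_le_iff_ne_zero.2 hi
  have h2 : jacobiGap α β ≤ α i + β i + 2 :=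
    ciInf_le (Set.finite_range fun j => α j + β j + 2).bddBelow i
  have h3 : (κ i : ℝ) * (κ i + α i + β i + 1) ≤ jacobiEigenvalue α β κ :=
    Finset.single_le_sum (f := fun i => (κ i : ℝ) * (κ i + α i + β i + 1)) (fun j _ => by
      have h4 := hαβ j
      have h5 : (0 : ℝ) ≤ κ j := by positivity
      exact mul_nonneg h5 (by linarith)) (Finset.mem_univ i)
  nlinarith [hαβ i]

/-- Exponential decay of the Jacobi semigroup on functions of mean zero, uniformly on the cube. -/
theorem exists_abs_jacobiSemigroup_le (hd : 0 < d) (hα : ∀ i, -1 < α i) (hβ : ∀ i, -1 < β i)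
    (hαβ : ∀ i, 0 < α i + β i + 1) {g : (Fin d → ℝ) → ℝ}
    (hg : ContinuousOn g (Icc (fun _ => -1) fun _ => 1))
    (hg0 : ∫ y, g y * jacobiPoly α β 0 y ∂(jacobiMeasurePi α β) = 0) :
    ∃ C : ℝ, 0 ≤ C ∧ ∀ t : ℝ, 0 < t → ∀ x ∈ Icc (fun _ => -1) (fun _ => 1),
      |jacobiSemigroup α β t g x| ≤ C * Real.exp (-jacobiGap α β * t) := by
  obtain ⟨M, hM0, hM, hs⟩ := exists_jacobiPoly_bound hα hβ hαβ
  obtain ⟨G, hG⟩ := isCompact_Icc.exists_bound_of_continuousOn hg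
  have hG0 : 0 ≤ G := (norm_nonneg _).trans (hG (fun _ => 0) ⟨fun _ => by simp, fun _ => by simp⟩)
  have hgap := jacobiGap_pos hd hαβ
  set γ := jacobiGap α β
  set K := G * (jacobiMeasurePi α β).real univ with hK
  have hK0 : 0 ≤ K := by positivity
  set R := ∑' κ, Real.exp (-jacobiEigenvalue α β κ * 1) * M κ ^ 2 with hR
  have hR0 : 0 ≤ R := tsum_nonneg fun κ => by positivity
  refine ⟨(G + K * R) * Real.exp γ, by positivity, fun t ht x hx => ?_⟩
  rw [mul_assoc, ← Real.exp_add]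
  -- For t ≤ 1 the contraction suffices, since the factor exp γ in the constant outweighs the decay.
  -- For t ≥ 1 the series is compared with its majorant at time 1.
  rcases le_total t 1 with h1 | h1
  · refine (abs_jacobiSemigroup_le hα hβ hαβ hG ht hx).trans ?_
    have h2 : 1 ≤ Real.exp (γ + -γ * t) := Real.one_le_exp (by nlinarith)
    nlinarith [mul_nonneg hK0 hR0]
  · have hsum := hasSum_jacobiSemigroup hα hβ hαβ hg ht hx
    have hle : ∀ κ, ‖Real.exp (-jacobiEigenvalue α β κ * t) * jacobiPoly α β κ x *
        ∫ y, g y * jacobiPoly α β κ y ∂(jacobiMeasurePi α β)‖ ≤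
        K * Real.exp (γ + -γ * t) * (Real.exp (-jacobiEigenvalue α β κ * 1) * M κ ^ 2) := by
      intro κ
      rcases eq_or_ne κ 0 with rfl | hκ
      · rw [hg0, mul_zero, norm_zero]
        positivity
      · have h3 := jacobiGap_le_jacobiEigenvalue hαβ hκ
        have h4 := abs_integral_mul_jacobiPoly_le hα hβ hG0 hG (hM κ)
        -- This is (λ_κ - γ)(t - 1) ≥ 0.
        have h5 : Real.exp (-jacobiEigenvalue α β κ * t) ≤
            Real.exp (γ + -γ * t) * Real.exp (-jacobiEigenvalue α β κ * 1) := by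
          rw [← Real.exp_add]
          refine Real.exp_le_exp.2 ?_
          nlinarith
        rw [norm_mul, norm_mul, Real.norm_of_nonneg (Real.exp_pos _).le, Real.norm_eq_abs,
          Real.norm_eq_abs]
        calc _ ≤ Real.exp (γ + -γ * t) * Real.exp (-jacobiEigenvalue α β κ * 1) * M κ *
              (G * M κ * (jacobiMeasurePi α β).real univ) := by
              gcongr
              · exact mul_nonneg (by positivity) (hM0 κ)
              · exact hM κ x hx
          _ = _ := by rw [hK]; ring
    have h6 := tsum_of_norm_bounded ((hs 1 one_pos).hasSum.mul_left (K * Real.exp (γ + -γ * t))) hle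
    rw [hsum.tsum_eq, Real.norm_eq_abs] at h6
    refine h6.trans ?_
    have : 0 ≤ G * Real.exp (γ + -γ * t) := by positivity
    rw [← hR]
    nlinarith

/-- If `g` is the image of `f` under the Jacobi operator (on the level of coefficients), then
`g` evolves as the time derivative of `f`. -/
theorem hasDerivAt_jacobiSemigroup (hα : ∀ i, -1 < α i) (hβ : ∀ i, -1 < β i)
    (hαβ : ∀ i, 0 < α i + β i + 1) {f g : (Fin d → ℝ) → ℝ}
    (hf : ContinuousOn f (Icc (fun _ => -1) fun _ => 1))
    (hg : ContinuousOn g (Icc (fun _ => -1) fun _ => 1))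
    (hfg : ∀ κ, ∫ y, g y * jacobiPoly α β κ y ∂(jacobiMeasurePi α β) =
      -jacobiEigenvalue α β κ * ∫ y, f y * jacobiPoly α β κ y ∂(jacobiMeasurePi α β))
    {t : ℝ} (ht : 0 < t) {x : Fin d → ℝ} (hx : x ∈ Icc (fun _ => -1) (fun _ => 1)) :
    HasDerivAt (fun s => jacobiSemigroup α β s f x) (jacobiSemigroup α β t g x) t := by
  obtain ⟨M, hM0, hM, hs⟩ := exists_jacobiPoly_bound hα hβ hαβ
  obtain ⟨G, hG⟩ := isCompact_Icc.exists_bound_of_continuousOn hg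
  have hG0 : 0 ≤ G := (norm_nonneg _).trans (hG x hx)
  have hpos : ∀ κ, 0 ≤ jacobiEigenvalue α β κ := fun κ => Finset.sum_nonneg fun j _ => by
    have h4 := hαβ j
    have h5 : (0 : ℝ) ≤ κ j := by positivity
    exact mul_nonneg h5 (by linarith)
  have key := hasDerivAt_tsum_of_isPreconnected
    (g := fun κ s => Real.exp (-jacobiEigenvalue α β κ * s) * jacobiPoly α β κ x *
      ∫ y, f y * jacobiPoly α β κ y ∂(jacobiMeasurePi α β))
    (g' := fun κ s => Real.exp (-jacobiEigenvalue α β κ * s) * jacobiPoly α β κ x *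
      ∫ y, g y * jacobiPoly α β κ y ∂(jacobiMeasurePi α β))
    -- Staying beyond t/2 gives one summable majorant, the heat factor at time t/2, for all the
    -- differentiated terms.
    (t := Ioi (t / 2)) (y₀ := t) (y := t)
    ((hs (t / 2) (by linarith)).mul_left (G * (jacobiMeasurePi α β).real univ))
    isOpen_Ioi isPreconnected_Ioi (fun κ s _ => ?_) (fun κ s hst => ?_)
    (by simpa using ht) (hasSum_jacobiSemigroup hα hβ hαβ hf ht hx).summable (by simpa using ht)
  · rw [(hasSum_jacobiSemigroup hα hβ hαβ hg ht hx).tsum_eq] at key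
    refine key.congr_of_eventuallyEq ?_
    filter_upwards [Ioi_mem_nhds ht] with s hs
    exact (hasSum_jacobiSemigroup hα hβ hαβ hf hs hx).tsum_eq.symm
  · have h1 : HasDerivAt (fun s : ℝ => -jacobiEigenvalue α β κ * s) (-jacobiEigenvalue α β κ) s := by
      simpa using (hasDerivAt_id s).const_mul (-jacobiEigenvalue α β κ)
    refine ((h1.exp.mul_const _).mul_const _).congr_deriv ?_
    rw [hfg]
    ring
  · have h4 := abs_integral_mul_jacobiPoly_le hα hβ hG0 hG (hM κ)
    have h5 : Real.exp (-jacobiEigenvalue α β κ * s) ≤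
        Real.exp (-jacobiEigenvalue α β κ * (t / 2)) := by
      refine Real.exp_le_exp.2 ?_
      have := hpos κ
      have : t / 2 < s := hst
      nlinarith
    rw [norm_mul, norm_mul, Real.norm_of_nonneg (Real.exp_pos _).le, Real.norm_eq_abs,
      Real.norm_eq_abs]
    calc _ ≤ Real.exp (-jacobiEigenvalue α β κ * (t / 2)) * M κ *
          (G * M κ * (jacobiMeasurePi α β).real univ) := by
          gcongr
          · exact mul_nonneg (by positivity) (hM0 κ)
          · exact hM κ x hx
      _ = _ := by ring

end MultiDimensional

/-! ### The Jacobi operator on C² functions of the cube. -/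

section JacobiLaplacian

variable {d : ℕ} {α β : Fin d → ℝ}

theorem uniqueDiffOn_cube (d : ℕ) :
    UniqueDiffOn ℝ (Icc (fun _ : Fin d => (-1 : ℝ)) fun _ => 1) := by
  rw [← Set.pi_univ_Icc]
  exact UniqueDiffOn.univ_pi fun _ => uniqueDiffOn_Icc (by norm_num)

/-- The `i`-th partial derivative within the cube `[-1, 1]^d`. -/
noncomputable def cubePartial (i : Fin d) (F : (Fin d → ℝ) → ℝ) (x : Fin d → ℝ) : ℝ :=
  fderivWithin ℝ F (Icc (fun _ => -1) fun _ => 1) x (Pi.single i 1)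

theorem ContDiffOn.cubePartial {F : (Fin d → ℝ) → ℝ} {m n : ℕ}
    (hF : ContDiffOn ℝ n F (Icc (fun _ => -1) fun _ => 1)) (hmn : m + 1 ≤ n) (i : Fin d) :
    ContDiffOn ℝ m (cubePartial i F) (Icc (fun _ => -1) fun _ => 1) :=
  (hF.fderivWithin (uniqueDiffOn_cube d) (by exact_mod_cast hmn)).clm_apply contDiffOn_const

theorem update_mem_cube {x : Fin d → ℝ} (hx : x ∈ Icc (fun _ : Fin d => (-1 : ℝ)) fun _ => 1)
    {i : Fin d} {r : ℝ} (hr : r ∈ Icc (-1 : ℝ) 1) :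
    Function.update x i r ∈ Icc (fun _ : Fin d => (-1 : ℝ)) fun _ => 1 := by
  constructor <;> intro j <;> rcases eq_or_ne j i with rfl | h
  · simpa using hr.1
  · simpa [h] using hx.1 j
  · simpa using hr.2
  · simpa [h] using hx.2 j

theorem ContinuousOn.comp_update_cube {F : (Fin d → ℝ) → ℝ}
    (hF : ContinuousOn F (Icc (fun _ => -1) fun _ => 1)) {x : Fin d → ℝ}
    (hx : x ∈ Icc (fun _ => -1) fun _ => 1) (i : Fin d) :
    ContinuousOn (fun r => F (Function.update x i r)) (Icc (-1) 1) :=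
  hF.comp (show Continuous fun r : ℝ => Function.update x i r from
    continuous_const.update i continuous_id).continuousOn fun _ hr => update_mem_cube hx hr

/-- Only the i-th coordinate moves, so r being interior is enough even when the point lies on
another face of the cube. -/
theorem hasDerivAt_comp_update_cube {F : (Fin d → ℝ) → ℝ}
    (hF : ContDiffOn ℝ 1 F (Icc (fun _ => -1) fun _ => 1)) {x : Fin d → ℝ}
    (hx : x ∈ Icc (fun _ => -1) fun _ => 1) (i : Fin d) {r : ℝ} (hr : r ∈ Ioo (-1 : ℝ) 1) :
    HasDerivAt (fun r => F (Function.update x i r)) (cubePartial i F (Function.update x i r)) r := by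
  have h1 := (hF.differentiableOn one_ne_zero _
    (update_mem_cube hx (i := i) (Ioo_subset_Icc_self hr))).hasFDerivWithinAt
  have h2 := h1.comp_hasDerivWithinAt r (hasDerivAt_update x i r).hasDerivWithinAt
    (fun s hs => update_mem_cube hx hs : MapsTo _ (Icc (-1 : ℝ) 1) _)
  exact h2.hasDerivAt (Icc_mem_nhds hr.1 hr.2)

theorem integral_jacobiMeasurePi_succ {n : ℕ} {α β : Fin (n + 1) → ℝ} (hα : ∀ i, -1 < α i)
    (hβ : ∀ i, -1 < β i) (i : Fin (n + 1)) {F : (Fin (n + 1) → ℝ) → ℝ}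
    (hF : Integrable F (jacobiMeasurePi α β)) :
    ∫ x, F x ∂(jacobiMeasurePi α β) =
      ∫ y, ∫ r, F (i.insertNth r y) ∂(jacobiMeasure (α i) (β i))
        ∂(jacobiMeasurePi (fun j => α (i.succAbove j)) fun j => β (i.succAbove j)) := by
  have := fun i => isFiniteMeasure_jacobiMeasure (hα i) (hβ i)
  have h := (measurePreserving_piFinSuccAbove (fun i => jacobiMeasure (α i) (β i)) i).symm
  rw [jacobiMeasurePi, ← h.integral_comp', integral_prod_symm]
  · rfl
  · exact (h.integrable_comp_emb (MeasurableEquiv.measurableEmbedding _)).2 hF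

/-- The `i`-th summand of the Jacobi operator on the cube. -/
noncomputable def cubeJacobiDiff (α β : Fin d → ℝ) (i : Fin d) (f : (Fin d → ℝ) → ℝ)
    (x : Fin d → ℝ) : ℝ :=
  jacobiDiff (α i) (β i) (x i) (cubePartial i f x) (cubePartial i (cubePartial i f) x)

theorem continuousOn_cubeJacobiDiff {f : (Fin d → ℝ) → ℝ}
    (hf : ContDiffOn ℝ 2 f (Icc (fun _ => -1) fun _ => 1)) (i : Fin d) :
    ContinuousOn (cubeJacobiDiff α β i f) (Icc (fun _ => -1) fun _ => 1) := by
  have h1 : ContDiffOn ℝ (1 : ℕ) (cubePartial i f) (Icc (fun _ => -1) fun _ => 1) :=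
    ContDiffOn.cubePartial (n := 2) hf le_rfl i
  have h2 := (ContDiffOn.cubePartial (m := 0) h1 le_rfl i).continuousOn
  have h1 := h1.continuousOn
  unfold cubeJacobiDiff jacobiDiff
  fun_prop

theorem integrable_mul_jacobiPoly (hα : ∀ i, -1 < α i) (hβ : ∀ i, -1 < β i)
    {g : (Fin d → ℝ) → ℝ} (hg : ContinuousOn g (Icc (fun _ => -1) fun _ => 1)) (κ : Fin d → ℕ) :
    Integrable (fun x => g x * jacobiPoly α β κ x) (jacobiMeasurePi α β) :=
  integrable_jacobiMeasurePi hα hβ (hg.mul (continuous_jacobiPoly κ).continuousOn)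

/-- Fubini with the i-th variable innermost: on each line the other factors of the polynomial are
constant, and the one-dimensional symmetry applies. -/
theorem integral_cubeJacobiDiff_mul_jacobiPoly (hα : ∀ i, -1 < α i) (hβ : ∀ i, -1 < β i)
    {f : (Fin d → ℝ) → ℝ} (hf : ContDiffOn ℝ 2 f (Icc (fun _ => -1) fun _ => 1)) (i : Fin d)
    (κ : Fin d → ℕ) :
    ∫ x, cubeJacobiDiff α β i f x * jacobiPoly α β κ x ∂(jacobiMeasurePi α β) =
      -jacobiEig (α i) (β i) (κ i) *
        ∫ x, f x * jacobiPoly α β κ x ∂(jacobiMeasurePi α β) := by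
  obtain _ | n := d
  · exact i.elim0
  have h1 : ContDiffOn ℝ (1 : ℕ) (cubePartial i f) (Icc (fun _ => -1) fun _ => 1) :=
    ContDiffOn.cubePartial (n := 2) hf le_rfl i
  have h2 := (ContDiffOn.cubePartial (m := 0) h1 le_rfl i).continuousOn
  rw [integral_jacobiMeasurePi_succ hα hβ i (integrable_mul_jacobiPoly hα hβ
      (continuousOn_cubeJacobiDiff hf i) κ),
    integral_jacobiMeasurePi_succ hα hβ i (integrable_mul_jacobiPoly hα hβ hf.continuousOn κ), ← integral_const_mul]
  refine integral_congr_ae ?_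
  filter_upwards [ae_mem_jacobiMeasurePi (fun j => hα (i.succAbove j))
    fun j => hβ (i.succAbove j)] with y hy
  set z : Fin (n + 1) → ℝ := i.insertNth 0 y with hz
  have hzmem : z ∈ Icc (fun _ => (-1 : ℝ)) fun _ => 1 := by
    rw [hz, Fin.insertNth_mem_Icc]
    exact ⟨by norm_num, hy⟩
  have hup : ∀ r : ℝ, (i.insertNth r y : Fin (n + 1) → ℝ) = Function.update z i r := by
    intro r
    rw [hz, Fin.update_insertNth]
  have hpoly : ∀ r : ℝ, jacobiPoly α β κ (Function.update z i r) =
      (jacobiPhi (α i) (β i) (κ i)).eval r *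
        ∏ j, (jacobiPhi (α (i.succAbove j)) (β (i.succAbove j)) (κ (i.succAbove j))).eval (y j) := by
    intro r
    rw [← hup, jacobiPoly_eq, Fin.prod_univ_succAbove _ i]
    simp
  have key := integral_jacobiDiff_mul_jacobiPhi (hα i) (hβ i) (κ i)
    (hf.continuousOn.comp_update_cube hzmem i) (h1.continuousOn.comp_update_cube hzmem i)
    (h2.comp_update_cube hzmem i)
    (fun r hr => hasDerivAt_comp_update_cube (hf.of_le (by norm_num)) hzmem i hr)
    (fun r hr => hasDerivAt_comp_update_cube h1 hzmem i hr)
  simp only [hup, hpoly, ← mul_assoc, cubeJacobiDiff, Function.update_self]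
  rw [integral_mul_const, integral_mul_const, key]
  ring

/-- The C² regularity of f enters here: L f is continuous up to the boundary, so the decay estimate
for continuous functions covers it too. -/
theorem exists_jacobiLaplacian (hα : ∀ i, -1 < α i) (hβ : ∀ i, -1 < β i)
    {f : (Fin d → ℝ) → ℝ} (hf : ContDiffOn ℝ 2 f (Icc (fun _ => -1) fun _ => 1)) :
    ∃ g : (Fin d → ℝ) → ℝ, ContinuousOn g (Icc (fun _ => -1) fun _ => 1) ∧
      ∀ κ, ∫ y, g y * jacobiPoly α β κ y ∂(jacobiMeasurePi α β) =
        -jacobiEigenvalue α β κ * ∫ y, f y * jacobiPoly α β κ y ∂(jacobiMeasurePi α β) := by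
  refine ⟨fun x => ∑ i, cubeJacobiDiff α β i f x,
    continuousOn_finsetSum _ fun i _ => continuousOn_cubeJacobiDiff hf i, fun κ => ?_⟩
  simp only [Finset.sum_mul]
  rw [integral_finsetSum _ fun i _ => integrable_mul_jacobiPoly hα hβ
    (continuousOn_cubeJacobiDiff hf i) κ]
  simp only [integral_cubeJacobiDiff_mul_jacobiPoly hα hβ hf]
  rw [← Finset.sum_mul, Finset.sum_neg_distrib]
  rfl

end JacobiLaplacian

/-! ### Subordination integrals and differentiation under them. -/

section Subordination

open Filter Topology

/-- The error function `∫ r in 0..z, exp (-r²)`. -/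
noncomputable def gaussPrimitive (z : ℝ) : ℝ := ∫ r in 0..z, Real.exp (-r ^ 2)

theorem hasDerivAt_gaussPrimitive (z : ℝ) :
    HasDerivAt gaussPrimitive (Real.exp (-z ^ 2)) z := by
  have hc : Continuous fun r : ℝ => Real.exp (-r ^ 2) := by fun_prop
  exact intervalIntegral.integral_hasDerivAt_right (hc.intervalIntegrable _ _)
    (hc.stronglyMeasurableAtFilter _ _) hc.continuousAt

theorem tendsto_gaussPrimitive_atTop : Tendsto gaussPrimitive atTop (𝓝 (√Real.pi / 2)) := by
  have h1 := integral_gaussian_Ioi 1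
  have h2 := (integrable_exp_neg_mul_sq one_pos).integrableOn (s := Ioi (0 : ℝ))
  have h3 := intervalIntegral_tendsto_integral_Ioi 0 h2 tendsto_id
  rw [h1, div_one] at h3
  refine h3.congr fun z => ?_
  simp [gaussPrimitive]

theorem gaussPrimitive_neg (z : ℝ) : gaussPrimitive (-z) = -gaussPrimitive z := by
  have h := intervalIntegral.integral_comp_neg (a := 0) (b := z) fun r : ℝ => Real.exp (-r ^ 2)
  simp only [neg_sq, neg_zero] at h
  rw [gaussPrimitive, gaussPrimitive, h, intervalIntegral.integral_symm]

theorem tendsto_gaussPrimitive_atBot : Tendsto gaussPrimitive atBot (𝓝 (-(√Real.pi / 2))) := by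
  have h := (tendsto_gaussPrimitive_atTop.comp tendsto_neg_atBot_atTop).neg
  refine h.congr fun z => ?_
  simp [gaussPrimitive_neg]

/-- The fundamental theorem of calculus on `(0, ∞)` for a nonnegative derivative and a function
with limits at both ends. -/
theorem integral_Ioi_zero_of_hasDerivAt_of_nonneg {F F' : ℝ → ℝ} {l m : ℝ}
    (hd : ∀ u ∈ Ioi (0 : ℝ), HasDerivAt F (F' u) u) (hpos : ∀ u ∈ Ioi (0 : ℝ), 0 ≤ F' u)
    (h0 : Tendsto F (𝓝[>] 0) (𝓝 l)) (h1 : Tendsto F atTop (𝓝 m)) :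
    IntegrableOn F' (Ioi 0) ∧ ∫ u in Ioi 0, F' u = m - l := by
  have hcont : ContinuousWithinAt (Function.update F 0 l) (Ici 0) 0 := by
    rw [continuousWithinAt_update_same, Ici_sdiff_left]
    exact h0
  have hd' : ∀ u ∈ Ioi (0 : ℝ), HasDerivAt (Function.update F 0 l) (F' u) u := fun u hu => by
    refine (hd u hu).congr_of_eventuallyEq ?_
    filter_upwards [isOpen_Ioi.mem_nhds hu] with v hv
    exact Function.update_of_ne (ne_of_gt hv) _ _
  have h1' : Tendsto (Function.update F 0 l) atTop (𝓝 m) := by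
    refine h1.congr' ?_
    filter_upwards [eventually_gt_atTop 0] with v hv
    exact (Function.update_of_ne hv.ne' _ _).symm
  refine ⟨integrableOn_Ioi_deriv_of_nonneg hcont hd' hpos h1', ?_⟩
  simpa using integral_Ioi_of_hasDerivAt_of_nonneg hcont hd' hpos h1'

/-- The square of √u + b/√u is u + 2b + b²/u, and exp(2b) removes the middle term. Adding the
versions for b and -b cancels the b/(2u) term and subtracting them cancels the 1/2, so both
subordination integrals have explicit antiderivatives. -/
theorem hasDerivAt_gaussPrimitive_sqrt (b : ℝ) {u : ℝ} (hu : 0 < u) :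
    HasDerivAt (fun u => Real.exp (2 * b) * gaussPrimitive (√u + b / √u))
      (Real.exp (-u) / √u * Real.exp (-(b ^ 2 / u)) * (1 / 2 - b / (2 * u))) u := by
  have hs : 0 < √u := Real.sqrt_pos.2 hu
  have h1 := Real.hasDerivAt_sqrt hu.ne'
  have h2 := h1.add ((hasDerivAt_const u b).fun_div h1 hs.ne')
  have h3 := ((hasDerivAt_gaussPrimitive (√u + b / √u)).comp u h2).const_mul (Real.exp (2 * b))
  refine h3.congr_deriv ?_
  have h4 : -(√u + b / √u) ^ 2 = -(2 * b) + (-u + -(b ^ 2 / u)) := by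
    have := Real.sq_sqrt hu.le
    field_simp
    rw [this]
    ring
  rw [h4, Real.exp_add, Real.exp_add, Real.sq_sqrt hu.le, Real.exp_neg (2 * b)]
  field_simp
  rw [Real.sq_sqrt hu.le]
  ring

theorem tendsto_sqrt_add_div_sqrt_atTop (b : ℝ) :
    Tendsto (fun u : ℝ => √u + b / √u) atTop atTop :=
  Real.tendsto_sqrt_atTop.atTop_add
    (tendsto_const_nhds.div_atTop Real.tendsto_sqrt_atTop)

theorem tendsto_sqrt_nhdsGT_zero : Tendsto (fun u : ℝ => √u) (𝓝[>] 0) (𝓝[>] 0) := by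
  refine tendsto_nhdsWithin_iff.2 ⟨?_, ?_⟩
  · have := Real.continuous_sqrt.tendsto 0
    rw [Real.sqrt_zero] at this
    exact this.mono_left nhdsWithin_le_nhds
  · filter_upwards [self_mem_nhdsWithin] with u hu
    exact Real.sqrt_pos.2 hu

theorem tendsto_sqrt_add_div_sqrt_zero {b : ℝ} (hb : 0 < b) :
    Tendsto (fun u : ℝ => √u + b / √u) (𝓝[>] 0) atTop := by
  have h := tendsto_sqrt_nhdsGT_zero
  refine (h.mono_right nhdsWithin_le_nhds).add_atTop ?_
  simp only [div_eq_mul_inv]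
  exact (tendsto_inv_nhdsGT_zero.comp h).const_mul_atTop hb

theorem tendsto_sqrt_sub_div_sqrt_zero {b : ℝ} (hb : 0 < b) :
    Tendsto (fun u : ℝ => √u + -b / √u) (𝓝[>] 0) atBot := by
  have h := tendsto_sqrt_nhdsGT_zero
  refine (h.mono_right nhdsWithin_le_nhds).add_atBot ?_
  simp only [div_eq_mul_inv]
  exact (tendsto_inv_nhdsGT_zero.comp h).const_mul_atTop_of_neg (by linarith)

/-- At infinity both arguments of the antiderivative tend to +∞, while at 0 they tend to opposite
infinities. The exp(2b) contributions cancel and exp(-2b) is counted twice. -/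
theorem integral_exp_neg_div_sqrt {b : ℝ} (hb : 0 < b) :
    IntegrableOn (fun u => Real.exp (-u) / √u * Real.exp (-(b ^ 2 / u))) (Ioi 0) ∧
      ∫ u in Ioi 0, Real.exp (-u) / √u * Real.exp (-(b ^ 2 / u)) =
        √Real.pi * Real.exp (-(2 * b)) := by
  have h := integral_Ioi_zero_of_hasDerivAt_of_nonneg
    (fun u hu => ((hasDerivAt_gaussPrimitive_sqrt b hu).add
      (hasDerivAt_gaussPrimitive_sqrt (-b) hu)).congr_deriv
        (g' := Real.exp (-u) / √u * Real.exp (-(b ^ 2 / u))) (by rw [neg_sq]; ring))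
    (fun u _ => by positivity)
    (((tendsto_gaussPrimitive_atTop.comp (tendsto_sqrt_add_div_sqrt_zero hb)).const_mul _).add
      ((tendsto_gaussPrimitive_atBot.comp (tendsto_sqrt_sub_div_sqrt_zero hb)).const_mul _))
    (((tendsto_gaussPrimitive_atTop.comp (tendsto_sqrt_add_div_sqrt_atTop b)).const_mul _).add
      ((tendsto_gaussPrimitive_atTop.comp (tendsto_sqrt_add_div_sqrt_atTop (-b))).const_mul _))
  refine ⟨h.1, h.2.trans ?_⟩
  rw [show 2 * -b = -(2 * b) by ring]
  ring

theorem integral_exp_neg_div_sqrt_mul {b : ℝ} (hb : 0 < b) :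
    IntegrableOn (fun u => Real.exp (-u) / √u * Real.exp (-(b ^ 2 / u)) * (b / u)) (Ioi 0) ∧
      ∫ u in Ioi 0, Real.exp (-u) / √u * Real.exp (-(b ^ 2 / u)) * (b / u) =
        √Real.pi * Real.exp (-(2 * b)) := by
  have h := integral_Ioi_zero_of_hasDerivAt_of_nonneg
    (fun u hu => ((hasDerivAt_gaussPrimitive_sqrt (-b) hu).sub
      (hasDerivAt_gaussPrimitive_sqrt b hu)).congr_deriv
        (g' := Real.exp (-u) / √u * Real.exp (-(b ^ 2 / u)) * (b / u)) (by rw [neg_sq]; ring))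
    (fun u hu => by
      have : 0 < u := hu
      positivity)
    (((tendsto_gaussPrimitive_atBot.comp (tendsto_sqrt_sub_div_sqrt_zero hb)).const_mul _).sub
      ((tendsto_gaussPrimitive_atTop.comp (tendsto_sqrt_add_div_sqrt_zero hb)).const_mul _))
    (((tendsto_gaussPrimitive_atTop.comp (tendsto_sqrt_add_div_sqrt_atTop (-b))).const_mul _).sub
      ((tendsto_gaussPrimitive_atTop.comp (tendsto_sqrt_add_div_sqrt_atTop b)).const_mul _))
  refine ⟨h.1, h.2.trans ?_⟩
  rw [show 2 * -b = -(2 * b) by ring]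
  ring

variable {h h' : ℝ → ℝ} {C γ : ℝ}

theorem norm_subordination_le (hb : ∀ s, 0 < s → |h s| ≤ C * Real.exp (-γ * s)) (hγ : 0 < γ) {t u : ℝ}
    (ht : 0 < t) (hu : 0 < u) :
    ‖Real.exp (-u) / √u * h (t ^ 2 / (4 * u))‖ ≤
      C * (Real.exp (-u) / √u * Real.exp (-((√γ * t / 2) ^ 2 / u))) := by
  rw [norm_mul, Real.norm_of_nonneg (by positivity), Real.norm_eq_abs]
  -- The choice b = √γ t/2 matches the explicit integrals, whose exponent 2b is then √γ t.
  have e : -γ * (t ^ 2 / (4 * u)) = -((√γ * t / 2) ^ 2 / u) := by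
    rw [div_pow, mul_pow, Real.sq_sqrt hγ.le]
    field_simp
    norm_num
  have h1 := hb (t ^ 2 / (4 * u)) (by positivity)
  rw [e] at h1
  calc _ ≤ Real.exp (-u) / √u * (C * Real.exp (-((√γ * t / 2) ^ 2 / u))) := by gcongr
    _ = _ := by ring

theorem abs_subordination_le (hγ : 0 < γ)
    (hb : ∀ s, 0 < s → |h s| ≤ C * Real.exp (-γ * s)) {t : ℝ} (ht : 0 < t) :
    |1 / √Real.pi * ∫ u in Ioi (0 : ℝ), Real.exp (-u) / √u * h (t ^ 2 / (4 * u))| ≤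
      C * Real.exp (-√γ * t) := by
  have hb0 : 0 < √γ * t / 2 := by positivity
  obtain ⟨h1, h2⟩ := integral_exp_neg_div_sqrt hb0
  have h3 := norm_integral_le_of_norm_le (h1.const_mul C)
    ((ae_restrict_mem measurableSet_Ioi).mono fun u hu => norm_subordination_le hb hγ ht hu)
  rw [integral_const_mul, h2, Real.norm_eq_abs] at h3
  have hpi : 0 < √Real.pi := Real.sqrt_pos.2 Real.pi_pos
  rw [abs_mul, abs_of_pos (by positivity), div_mul_eq_mul_div, one_mul, div_le_iff₀ hpi]
  refine h3.trans (le_of_eq ?_)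
  rw [show -(2 * (√γ * t / 2)) = -√γ * t by ring]
  ring

theorem hasDerivAt_subordination (hγ : 0 < γ) (hC : 0 ≤ C)
    (hd : ∀ s, 0 < s → HasDerivAt h (h' s) s)
    (hb : ∀ s, 0 < s → |h s| ≤ C * Real.exp (-γ * s))
    (hb' : ∀ s, 0 < s → |h' s| ≤ C * Real.exp (-γ * s)) {t : ℝ} (ht : 0 < t) :
    HasDerivAt (fun t => 1 / √Real.pi *
        ∫ u in Ioi (0 : ℝ), Real.exp (-u) / √u * h (t ^ 2 / (4 * u)))
      (1 / √Real.pi * ∫ u in Ioi (0 : ℝ),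
        Real.exp (-u) / √u * (h' (t ^ 2 / (4 * u)) * (t / (2 * u)))) t := by
  have hmeasw : Measurable fun u : ℝ => Real.exp (-u) / √u := by fun_prop
  have hcont : ContinuousOn h (Ioi 0) := fun s hs => (hd s hs).continuousAt.continuousWithinAt
  have hmeas : ∀ s : ℝ, 0 < s → AEStronglyMeasurable
      (fun u => Real.exp (-u) / √u * h (s ^ 2 / (4 * u))) (volume.restrict (Ioi 0)) := by
    intro s hs
    refine hmeasw.aestronglyMeasurable.mul ?_
    refine ContinuousOn.aestronglyMeasurable (hcont.comp ?_ ?_) measurableSet_Ioi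
    · refine continuousOn_const.div (by fun_prop) fun u hu => ?_
      have : 0 < u := hu
      positivity
    · intro u hu
      have : 0 < u := hu
      exact show 0 < s ^ 2 / (4 * u) by positivity
  have hmeas' : AEStronglyMeasurable
      (fun u => Real.exp (-u) / √u * (h' (t ^ 2 / (4 * u)) * (t / (2 * u))))
      (volume.restrict (Ioi 0)) := by
    -- Measurability of h' comes from its being the derivative of h on (0, ∞).
    have h1 : Measurable fun u : ℝ =>
        Real.exp (-u) / √u * (deriv h (t ^ 2 / (4 * u)) * (t / (2 * u))) := by
      have := (measurable_deriv h).comp (show Measurable fun u : ℝ => t ^ 2 / (4 * u) by fun_prop)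
      exact hmeasw.mul (this.mul (by fun_prop))
    refine h1.aestronglyMeasurable.congr ?_
    filter_upwards [ae_restrict_mem measurableSet_Ioi] with u hu
    have : 0 < u := hu
    rw [(hd (t ^ 2 / (4 * u)) (by positivity)).deriv]
  -- The Gaussian factor is largest at the left end t/2 of the neighbourhood and s/(2u) at the right
  -- end 3t/2; rewriting 3t/(4u) in terms of b/u gives the constant below.
  set b : ℝ := √γ * (t / 2) / 2 with hbdef
  have hb0 : 0 < b := by positivity
  have hint := (integral_exp_neg_div_sqrt_mul hb0).1.const_mul (C * (3 * t / 4 / b))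
  refine ((hasDerivAt_integral_of_dominated_loc_of_deriv_le (x₀ := t)
    (F := fun t u => Real.exp (-u) / √u * h (t ^ 2 / (4 * u)))
    (F' := fun t u => Real.exp (-u) / √u * (h' (t ^ 2 / (4 * u)) * (t / (2 * u))))
    (s := Ioo (t / 2) (3 * t / 2)) (Ioo_mem_nhds (by linarith) (by linarith)) ?_ ?_ hmeas' ?_ hint
    ?_).2).const_mul _
  · filter_upwards [Ioi_mem_nhds ht] with s hs
    exact hmeas s hs
  · exact Integrable.mono' ((integral_exp_neg_div_sqrt (b := √γ * t / 2) (by positivity)).1.const_mul C)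
      (hmeas t ht)
      ((ae_restrict_mem measurableSet_Ioi).mono fun u hu => norm_subordination_le hb hγ ht hu)
  · filter_upwards [ae_restrict_mem measurableSet_Ioi] with u hu s hs
    have hu : 0 < u := hu
    have hs0 : 0 < s := by linarith [hs.1]
    have h1 := norm_subordination_le hb' hγ hs0 hu
    rw [← mul_assoc, norm_mul, Real.norm_of_nonneg (show 0 ≤ s / (2 * u) by positivity)]
    have h2 : Real.exp (-((√γ * s / 2) ^ 2 / u)) ≤ Real.exp (-(b ^ 2 / u)) := by
      refine Real.exp_le_exp.2 (neg_le_neg ?_)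
      rw [hbdef]
      have := hs.1.le
      gcongr
    have h3 : s / (2 * u) ≤ 3 * t / 4 / u := by
      rw [div_le_div_iff₀ (by positivity) hu]
      nlinarith [hs.2]
    calc _ ≤ C * (Real.exp (-u) / √u * Real.exp (-((√γ * s / 2) ^ 2 / u))) * (s / (2 * u)) := by
          gcongr
      _ ≤ C * (Real.exp (-u) / √u * Real.exp (-(b ^ 2 / u))) * (3 * t / 4 / u) := by
          gcongr
      _ = _ := by field_simp
  · filter_upwards [ae_restrict_mem measurableSet_Ioi] with u hu s hs
    have hu : 0 < u := hu
    have hs0 : 0 < s := by linarith [hs.1]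
    have h1 : HasDerivAt (fun s : ℝ => s ^ 2 / (4 * u)) (s / (2 * u)) s := by
      refine ((hasDerivAt_pow 2 s).div_const (4 * u)).congr_deriv ?_
      field_simp
      norm_num
      ring
    exact ((hd (s ^ 2 / (4 * u)) (by positivity)).comp s h1).const_mul _

/-- The chain rule factor t/(2u) is (b/u)/√γ with b = √γ t/2, exactly the weight of the second
explicit integral; hence no power of t is lost. -/
theorem abs_subordination_deriv_le (hγ : 0 < γ)
    (hb' : ∀ s, 0 < s → |h' s| ≤ C * Real.exp (-γ * s)) {t : ℝ} (ht : 0 < t) :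
    |1 / √Real.pi * ∫ u in Ioi (0 : ℝ),
        Real.exp (-u) / √u * (h' (t ^ 2 / (4 * u)) * (t / (2 * u)))| ≤
      C / √γ * Real.exp (-√γ * t) := by
  have hb0 : 0 < √γ * t / 2 := by positivity
  obtain ⟨h1, h2⟩ := integral_exp_neg_div_sqrt_mul hb0
  have h3 := norm_integral_le_of_norm_le (h1.const_mul (C / √γ))
    (f := fun u => Real.exp (-u) / √u * (h' (t ^ 2 / (4 * u)) * (t / (2 * u))))
    ((ae_restrict_mem measurableSet_Ioi).mono fun u hu => by
      have hu : 0 < u := hu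
      have h4 := norm_subordination_le hb' hγ ht hu
      rw [← mul_assoc, norm_mul, Real.norm_of_nonneg (show 0 ≤ t / (2 * u) by positivity)]
      refine (mul_le_mul_of_nonneg_right h4 (by positivity)).trans (le_of_eq ?_)
      field_simp)
  rw [integral_const_mul, h2, Real.norm_eq_abs] at h3
  have hpi : 0 < √Real.pi := Real.sqrt_pos.2 Real.pi_pos
  rw [abs_mul, abs_of_pos (by positivity), div_mul_eq_mul_div, one_mul, div_le_iff₀ hpi]
  refine h3.trans (le_of_eq ?_)
  rw [show -(2 * (√γ * t / 2)) = -√γ * t by ring]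
  ring

theorem integral_exp_neg_div_sqrt_zero : ∫ u in Ioi (0 : ℝ), Real.exp (-u) / √u = √Real.pi := by
  rw [← Real.Gamma_one_half_eq, Real.Gamma_eq_integral (by norm_num)]
  refine setIntegral_congr_fun measurableSet_Ioi fun u hu => ?_
  have hu : 0 < u := hu
  rw [show (1 / 2 - 1 : ℝ) = -(1 / 2) by norm_num, Real.rpow_neg hu.le, ← Real.sqrt_eq_rpow,
    div_eq_mul_inv]

end Subordination

/-! ### Assembly of the estimates. -/

theorem mainTheorem9 {d : ℕ} (hd : 0 < d) (α β : Fin d → ℝ)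
    (hα : ∀ i, -(1 / 2) < α i) (hβ : ∀ i, -(1 / 2) < β i)
    (f : (Fin d → ℝ) → ℝ) (hf : ContDiffOn ℝ 2 f (Set.Icc (fun _ => -1) (fun _ => 1)))
    (hmean : ∫ y, f y ∂(jacobiMeasurePi α β) = 0) :
    ∃ C : ℝ, ∀ x ∈ Set.Icc (fun _ : Fin d => (-1 : ℝ)) (fun _ => 1),
      (∀ t : ℝ, 0 < t →
        DifferentiableAt ℝ (fun s => poissonJacobi α β s f x) t ∧
        |deriv (fun s => poissonJacobi α β s f x) t| ≤
          C * (1 + ‖WithLp.toLp 2 x‖) * Real.exp (-√(jacobiGap α β) * t)) ∧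
      (∀ t : ℝ, 0 ≤ t →
        |poissonJacobi α β t f x| ≤
          C * (1 + ‖WithLp.toLp 2 x‖) * Real.exp (-√(jacobiGap α β) * t)) := by
  have hα1 : ∀ i, -1 < α i := fun i => by linarith [hα i]
  have hβ1 : ∀ i, -1 < β i := fun i => by linarith [hβ i]
  have hαβ : ∀ i, 0 < α i + β i + 1 := fun i => by linarith [hα i, hβ i]
  obtain ⟨g, hg, hfg⟩ := exists_jacobiLaplacian hα1 hβ1 hf
  -- The polynomial of index 0 is constant, so mean zero means a vanishing coefficient.
  have hf0 : ∫ y, f y * jacobiPoly α β 0 y ∂(jacobiMeasurePi α β) = 0 := by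
    have h1 : ∀ i, ∃ v, jacobiPhi (α i) (β i) 0 = Polynomial.C v := fun i =>
      ⟨_, Polynomial.eq_C_of_natDegree_le_zero (natDegree_jacobiPhi_le (α i) (β i) 0)⟩
    choose v hv using h1
    simp only [jacobiPoly_eq, Pi.zero_apply, hv, Polynomial.eval_C]
    rw [integral_mul_const, hmean, zero_mul]
  have hg0 : ∫ y, g y * jacobiPoly α β 0 y ∂(jacobiMeasurePi α β) = 0 := by
    rw [hfg, hf0, mul_zero]
  obtain ⟨C₁, hC₁, h₁⟩ := exists_abs_jacobiSemigroup_le hd hα1 hβ1 hαβ hf.continuousOn hf0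
  obtain ⟨C₂, hC₂, h₂⟩ := exists_abs_jacobiSemigroup_le hd hα1 hβ1 hαβ hg hg0
  obtain ⟨G, hG⟩ := isCompact_Icc.exists_bound_of_continuousOn hf.continuousOn
  have hγ := jacobiGap_pos hd hαβ
  set γ := jacobiGap α β
  have hG0 : 0 ≤ G := (norm_nonneg _).trans (hG (fun _ => 0) ⟨fun _ => by simp, fun _ => by simp⟩)
  have hsγ : 0 < √γ := Real.sqrt_pos.2 hγ
  have hwk : ∀ (K : ℝ) (x : Fin d → ℝ) (t : ℝ), 0 ≤ K → K ≤ C₁ + C₂ / √γ + G →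
      K * Real.exp (-√γ * t) ≤
        (C₁ + C₂ / √γ + G) * (1 + ‖WithLp.toLp 2 x‖) * Real.exp (-√γ * t) := by
    intro K x t hK0 hK
    refine mul_le_mul_of_nonneg_right ?_ (Real.exp_pos _).le
    have h1 : 0 ≤ ‖WithLp.toLp 2 x‖ := norm_nonneg _
    nlinarith [mul_nonneg (hK0.trans hK) h1]
  have hC₂' : 0 ≤ C₂ / √γ := div_nonneg hC₂ hsγ.le
  -- The summands serve P_t f for t > 0, its derivative, and the value f(x) at t = 0.
  refine ⟨C₁ + C₂ / √γ + G, fun x hx => ⟨fun t ht => ?_, fun t ht => ?_⟩⟩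
  · have hder := hasDerivAt_subordination (h := fun s => jacobiSemigroup α β s f x)
      (h' := fun s => jacobiSemigroup α β s g x) (C := C₁ + C₂) hγ (by linarith)
      (fun s hs => hasDerivAt_jacobiSemigroup hα1 hβ1 hαβ hf.continuousOn hg hfg hs hx)
      (fun s hs => (h₁ s hs x hx).trans (by gcongr; linarith))
      (fun s hs => (h₂ s hs x hx).trans (by gcongr; linarith)) ht
    have hder : HasDerivAt (fun s => poissonJacobi α β s f x) _ t := hder
    refine ⟨hder.differentiableAt, ?_⟩
    rw [hder.deriv]
    exact (abs_subordination_deriv_le hγ (fun s hs => h₂ s hs x hx) ht).trans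
      (hwk _ x t hC₂' (by linarith))
  · rcases ht.eq_or_lt with rfl | ht
    · have hpi : √Real.pi ≠ 0 := (Real.sqrt_pos.2 Real.pi_pos).ne'
      have e : poissonJacobi α β 0 f x = f x := by
        simp only [poissonJacobi, jacobiSemigroup, ne_eq, OfNat.ofNat_ne_zero, not_false_eq_true,
          zero_pow, zero_div, if_true]
        rw [integral_mul_const, integral_exp_neg_div_sqrt_zero]
        field_simp
      rw [e]
      exact (hG x hx).trans (le_trans (by simp) (hwk G x 0 hG0 (by linarith)))
    · exact (abs_subordination_le hγ (fun s hs => h₁ s hs x hx) ht).trans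
        (hwk _ x t hC₁ (by linarith))
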